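/- Let $m\ge1$, $K>0$, $\beta>2$, $W\ge0$, $\gamma\in[0,1]$ with $W>0$ or $\gamma>0$. For $j=1,\dots,m$ let $\lambda_j>0$, $\tau_j>0$, and let $\Phi_1,\dots,\Phi_m$ be independent homogeneous Poisson point processes on $\mathbb R^2$ with densities $\lambda_j$ (the tiers of base stations). Each $\Phi_j$ is independently marked: given $\Phi_j$, its points $X$ carry i.i.d. pairs $(S_X,P_X)$ of positive random variables (propagation effect and power), distributed as $(S_j,P_j)$, with $\mathbf E[(P_jS_j)^{2/\beta}]<\infty$; the marked processes of different tiers are independent. Put $$\lambda_j^*=\lambda_j\,\mathbf E[(P_jS_j)^{2/\beta}],\qquad \lambda^*=\sum_{j=1}^m\lambda_j^* .$$ For a station $X$ of the network $\Phi=\bigcup_j\Phi_j$ let $Y_X=(K|X|)^\beta/(P_XS_X)$, $I=\sum_{X\in\Phi}Y_X^{-1}$, $$Z_X=\frac{Y_X^{-1}}{W+\gamma(I-Y_X^{-1})},\qquad T_X=\tau_j\ \text{ if } X\in\Phi_j .$$ For $t_1,\dots,t_n>0$ let $$M^{(n)}(t_1,\dots,t_n)=\mathbf E\Bigl[\sum_{(X_1,\dots,X_n)\in\Phi^n\text{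 distinct}}\ \prod_{j=1}^n\mathbf 1(Z_{X_j}>t_j)\Bigr]$$ be the factorial moment measure of the SINR process (sum over ordered $n$-tuples). Let $\mathcal N$ be the number of stations $X$ with $Z_X>T_X$, and let $$\mathcal S_n=\mathbf E\bigl[\#\{A\subset\Phi:\ |A|=n,\ Z_X>T_X\text{ for all }X\in A\}\bigr]$$ be the expected number of ways of choosing $n$ different stations (without order) that all cover the user; $\mathcal S_0=1$. Then for every $n\ge0$ the quantity $\mathcal S_n$ is finite and $$\mathcal S_n=\frac1{n!}\sum_{(i_1,\dots,i_n)\in\{1,\dots,m\}^n}M^{(n)}(\tau_{i_1},\dots,\tau_{i_n})\prod_{j=1}^n\frac{\lambda^*_{i_j}}{\lambda^*} .$$ Moreover, for every $k\ge1$, with absolutely convergent series, $$\mathbf P\{\mathcal N\ge k\}=\sum_{n=k}^\infty(-1)^{n-k}\binom{n-1}{k-1}\mathcal S_n,\qquad \mathbf P\{\mathcal N=k\}=\sum_{n=k}^\infty(-1)^{n-k}\binom nk\mathcal S_n .$$ If $\gamma>0$ and $t_{\min}>0$ satisfies $t_{\min}\le\tau_j$ for all $j$, then $\mathcal S_n=0$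 for all $n\ge 1/(\gamma t_{\min})+1$, and both series may be stopped at $n=\lceil1/(\gamma t_{\min})\rceil$. -/

import Mathlib

open MeasureTheory ProbabilityTheory
open scoped ENNReal

noncomputable section

/-! ### Point processes, given by a sequence of random points -/

/-- The plane, with its Euclidean norm and Lebesgue measure. -/
abbrev Plane : Type := EuclideanSpace ℝ (Fin 2)

/-- The number of points of the sequence `X` that lie in `A`. -/
def pointCount {Ω : Type*} (X : ℕ → Ω → Plane) (A : Set Plane) (ω : Ω) : ℕ∞ :=
  {k : ℕ | X k ω ∈ A}.encard

/-- `{X k : k ∈ ℕ}` is a homogeneous Poisson point process on the plane with density `lam`: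
the number of points in a measurable set `A` of finite area `|A|` is Poisson distributed with mean
`lam * |A|`, and the numbers of points in pairwise disjoint such sets are independent. -/
structure IsPoissonProcess {Ω : Type*} [MeasurableSpace Ω] (μ : Measure Ω) (lam : ℝ)
    (X : ℕ → Ω → Plane) : Prop where
  measurable : ∀ k, Measurable (X k)
  law : ∀ A : Set Plane, MeasurableSet A → volume A ≠ ∞ → ∀ n : ℕ,
    μ {ω | pointCount X A ω = n} = poissonMeasure (lam * volume.real A).toNNReal {n}
  indep : ∀ (r : ℕ) (A : Fin r → Set Plane), (∀ i, MeasurableSet (A i)) →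
    (∀ i, volume (A i) ≠ ∞) → Pairwise (fun i j => Disjoint (A i) (A j)) →
    iIndepFun (fun i => pointCount X (A i)) μ

/-- `{(X k, Q k) : k ∈ ℕ}` is an independently marked homogeneous Poisson point process: given the
points, the marks `Q k = (S, P)` are independent and identically distributed with law `ν`. -/
structure IsMarkedPoissonProcess {Ω : Type*} [MeasurableSpace Ω] (μ : Measure Ω) (lam : ℝ)
    (ν : Measure (ℝ × ℝ)) (X : ℕ → Ω → Plane) (Q : ℕ → Ω → ℝ × ℝ) : Prop where
  poisson : IsPoissonProcess μ lam X
  measurable_mark : ∀ k, Measurable (Q k)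
  law_mark : ∀ k, μ.map (Q k) = ν
  indep_mark : iIndepFun Q μ
  indep_points_marks : IndepFun (fun ω k => X k ω) (fun ω k => Q k ω) μ

/-- The `m`-tier network: `m` independent, independently marked homogeneous Poisson processes, tier
`j` having density `lam j` and law `ν j` of the pair (propagation effect `S`, power `P`). The base
stations of the superposition are indexed by the pairs `(j, k)`, `k`-th station of tier `j`. -/
structure IsMultiTierNetwork {Ω : Type*} [MeasurableSpace Ω] (μ : Measure Ω) {m : ℕ}
    (lam : Fin m → ℝ) (ν : Fin m → Measure (ℝ × ℝ))
    (X : Fin m → ℕ → Ω → Plane) (Q : Fin m → ℕ → Ω → ℝ × ℝ) : Prop where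
  tier : ∀ j, IsMarkedPoissonProcess μ (lam j) (ν j) (X j) (Q j)
  indep_tiers : iIndepFun (fun j ω => ((fun k => X j k ω), (fun k => Q j k ω))) μ

/-! ### Propagation losses and SINR values -/

/-- The path-loss function `ℓ(r) = (K r) ^ β`. -/
def pathLoss (K β r : ℝ) : ℝ := (K * r) ^ β

/-- The propagation loss `Y = ℓ(|x|) / (P S)` of a station at `x` with mark `q = (S, P)`. -/
def propagationLoss (K β : ℝ) (x : Plane) (q : ℝ × ℝ) : ℝ := pathLoss K β ‖x‖ / (q.2 * q.1)

/-- The power `Y⁻¹` received from station `p`. -/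
def receivedPower {Ω : Type*} {m : ℕ} (K β : ℝ) (X : Fin m → ℕ → Ω → Plane)
    (Q : Fin m → ℕ → Ω → ℝ × ℝ) (p : Fin m × ℕ) (ω : Ω) : ℝ≥0∞ :=
  ENNReal.ofReal (propagationLoss K β (X p.1 p.2 ω) (Q p.1 p.2 ω))⁻¹

/-- The power `I = ∑ Y⁻¹` received from the entire network. -/
def totalPower {Ω : Type*} {m : ℕ} (K β : ℝ) (X : Fin m → ℕ → Ω → Plane)
    (Q : Fin m → ℕ → Ω → ℝ × ℝ) (ω : Ω) : ℝ≥0∞ :=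
  ∑' p, receivedPower K β X Q p ω

/-- The SINR value `Y⁻¹ / (W + γ (I - Y⁻¹))` of station `p`. -/
def sinr {Ω : Type*} {m : ℕ} (K β W γ : ℝ) (X : Fin m → ℕ → Ω → Plane)
    (Q : Fin m → ℕ → Ω → ℝ × ℝ) (p : Fin m × ℕ) (ω : Ω) : ℝ≥0∞ :=
  receivedPower K β X Q p ω /
    (ENNReal.ofReal W +
      ENNReal.ofReal γ * (totalPower K β X Q ω - receivedPower K β X Q p ω))

/-! ### Quantities attached to a (marked) process of SINR values indexed by the stations -/

/-- The factorial moment measure of order `n` of the process `{Z p}`, on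
`(t 0, ∞] × ⋯ × (t (n - 1), ∞]`: the expected number of ordered `n`-tuples of distinct
stations whose values exceed `t 0, …, t (n - 1)` respectively. -/
def factorialMoment {Ω ι : Type*} [MeasurableSpace Ω] (μ : Measure Ω) (Z : ι → Ω → ℝ≥0∞)
    {n : ℕ} (t : Fin n → ℝ) : ℝ≥0∞ :=
  ∫⁻ ω, ∑' e : Fin n ↪ ι,
    ∏ i : Fin n, {ω' | ENNReal.ofReal (t i) < Z (e i) ω'}.indicator 1 ω ∂μ

/-- The `n`-th symmetric sum of the marked process `{(Z p, T p)}` (deterministic marks `T`): the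
expected number of ways of choosing `n` different stations, without regard to order, each of which
has its value above its threshold. -/
def symmetricSum {Ω ι : Type*} [MeasurableSpace Ω] (μ : Measure Ω) (Z : ι → Ω → ℝ≥0∞)
    (T : ι → ℝ) (n : ℕ) : ℝ≥0∞ :=
  ∫⁻ ω, ∑' A : {A : Finset ι // A.card = n},
    ∏ p ∈ A.1, {ω' | ENNReal.ofReal (T p) < Z p ω'}.indicator 1 ω ∂μ

/-- The coverage number: the number of stations whose value exceeds their threshold. -/
def coverageNumber {Ω ι : Type*} (Z : ι → Ω → ℝ≥0∞) (T : ι → ℝ) (ω : Ω) : ℕ∞ :=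
  {p : ι | ENNReal.ofReal (T p) < Z p ω}.encard

/-- `λ*_j = λ_j E[(P_j S_j) ^ (2/β)]`, for a tier of density `lam` and mark law `ν`. -/
def effectiveDensity (β lam : ℝ) (ν : Measure (ℝ × ℝ)) : ℝ :=
  lam * ∫ q, (q.2 * q.1) ^ (2 / β) ∂ν

end

/-!
Write `V_p` for the power received from station `p` and `I = ∑ V_p`. The Laplace functional of the
network shows that, through the scaling property of the path loss, the pairs (received power, tier)
form a Poisson process whose intensity is a product measure, with tier weights proportional to
`λ*_j`. Hence the tier labels look like labels drawn independently with probabilities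
`λ*_j / λ*`; at the level of Laplace functionals this is `lintegral_expNeg_eq_of_average`.

The SINR of `p` exceeds `t` if and only if `V_p` exceeds a level that is a function of `t` and `I`
alone (`lt_sinr_iff`). For a fixed level, the Laplace functional with the extra factor
`exp (-n I)` yields the joint law with `I`, since finite measures on `[0, ∞]` are determined by
their Laplace transforms; an approximation of `I` from the right by simple functions then allows
the level to depend on `I` (`lintegral_expNeg_tsum_eq_tierAverage`). Consequently
`E ∏ (1 - θ u_p)` is the same when `u_p` is the indicator that `p` exceeds the threshold of its own
tier, and when `u_p` is the average of these indicators over a random tier. The coefficients of the powers of `-θ` are the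
expected elementary symmetric functions. For the first family they are the symmetric sums, for
the second one they expand into factorial moment measures, which gives the first identity. No
Campbell-Mecke formula for the multi-point configurations is needed.

All series converge because the number `N` of stations with SINR above the least threshold satisfies
`E 3 ^ N < ∞`: for `γ > 0` it is bounded, as `N` stations with SINR above `t` satisfy
`N < 1 / (γ t) + 1`, and for `γ = 0` it is Poisson distributed. The inclusion-exclusion identities
are those for the binomial coefficients `C(N, n)`, integrated term by term.
-/

open Filter Topology

/-! ### Laplace transforms on `[0, ∞]` -/

/-- `exp (-x)` as a function from `[0, ∞]` to `[0, 1]`, with `exp (-∞) = 0`. -/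
noncomputable def expNeg (x : ℝ≥0∞) : ℝ≥0∞ := EReal.exp (-(x : EReal))

lemma expNeg_zero : expNeg 0 = 1 := by simp [expNeg]

lemma expNeg_ofReal {x : ℝ} (hx : 0 ≤ x) :
    expNeg (ENNReal.ofReal x) = ENNReal.ofReal (Real.exp (-x)) := by
  rw [expNeg, EReal.coe_ennreal_ofReal, max_eq_left hx, ← EReal.coe_neg, EReal.exp_coe]

lemma expNeg_add (x y : ℝ≥0∞) : expNeg (x + y) = expNeg x * expNeg y := by
  rw [expNeg, expNeg, expNeg, ← EReal.exp_add, EReal.coe_ennreal_add,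
    EReal.neg_add (by simp) (by simp), sub_eq_add_neg]

lemma expNeg_sum {ι : Type*} (s : Finset ι) (f : ι → ℝ≥0∞) :
    expNeg (∑ i ∈ s, f i) = ∏ i ∈ s, expNeg (f i) := by
  classical
  induction s using Finset.induction_on with
  | empty => simp [expNeg_zero]
  | insert a s ha ih => rw [Finset.sum_insert ha, Finset.prod_insert ha, expNeg_add, ih]

lemma expNeg_natCast_mul (n : ℕ) (x : ℝ≥0∞) : expNeg (n * x) = expNeg x ^ n := by
  rw [← nsmul_eq_mul, ← Finset.card_range n, ← Finset.sum_const, expNeg_sum, Finset.prod_const]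

lemma continuous_expNeg : Continuous expNeg :=
  EReal.expHomeomorph.continuous.comp (continuous_neg.comp continuous_coe_ennreal_ereal)

lemma measurable_expNeg : Measurable expNeg := continuous_expNeg.measurable

lemma strictAnti_expNeg : StrictAnti expNeg := by
  intro x y h
  rw [expNeg, expNeg, EReal.exp_lt_exp_iff, EReal.neg_lt_neg_iff]
  exact EReal.coe_ennreal_lt_coe_ennreal_iff.2 h

lemma expNeg_le_one (x : ℝ≥0∞) : expNeg x ≤ 1 := by
  rw [← expNeg_zero]; exact strictAnti_expNeg.antitone bot_le

lemma expNeg_ne_top (x : ℝ≥0∞) : expNeg x ≠ ∞ := ((expNeg_le_one x).trans_lt ENNReal.one_lt_top).ne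

/-- `-log x`, truncated below at `0` and infinite at `x = 0`. On `[0, 1]` it is the inverse of
`expNeg`. -/
noncomputable def negLog (x : ℝ≥0∞) : ℝ≥0∞ := (-(ENNReal.log x)).toENNReal

lemma expNeg_negLog {x : ℝ≥0∞} (hx : x ≤ 1) : expNeg (negLog x) = x := by
  rw [expNeg, negLog, EReal.coe_toENNReal, neg_neg, ENNReal.exp_log]
  rw [← EReal.neg_le_neg_iff, neg_neg, neg_zero, ← ENNReal.log_one]
  exact ENNReal.log_monotone hx

lemma measurable_negLog : Measurable negLog := by
  unfold negLog
  exact ENNReal.measurable_log.neg.ereal_toENNReal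

lemma antitone_negLog : Antitone negLog := fun _ _ h =>
  EReal.toENNReal_le_toENNReal (EReal.neg_le_neg_iff.2 (ENNReal.log_monotone h))

lemma continuous_negLog : Continuous negLog :=
  EReal.continuous_toENNReal.comp (continuous_neg.comp ENNReal.continuous_log)

/-- A finite measure on `[0, ∞]` is determined by its Laplace transform at the natural numbers:
the polynomials in `exp (-x)` separate points of `[0, ∞]`. -/
lemma MeasureTheory.Measure.ext_of_lintegral_expNeg {P P' : Measure ℝ≥0∞} [IsFiniteMeasure P]
    [IsFiniteMeasure P']
    (h : ∀ n : ℕ, ∫⁻ x, expNeg (n * x) ∂P = ∫⁻ x, expNeg (n * x) ∂P') : P = P' := by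
  set f : ℝ≥0∞ → ℝ := fun x => (expNeg x).toReal
  have fm : Measurable f := measurable_expNeg.ennreal_toReal
  have fc : Continuous f :=
    ENNReal.continuousOn_toReal.comp_continuous continuous_expNeg expNeg_ne_top
  have f01 : ∀ x, f x ∈ Set.Icc (0 : ℝ) 1 := fun x =>
    ⟨ENNReal.toReal_nonneg,
      ENNReal.toReal_le_of_le_ofReal zero_le_one (by simpa using expNeg_le_one x)⟩
  have fpow : ∀ (n : ℕ) (ρ : Measure ℝ≥0∞), ∫ x, f x ^ n ∂ρ = (∫⁻ x, expNeg (n * x) ∂ρ).toReal := by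
    intro n ρ
    rw [← integral_toReal]
    · simp [f, expNeg_natCast_mul]
    · exact (measurable_expNeg.comp (measurable_const.mul measurable_id)).aemeasurable
    · exact .of_forall fun x => (expNeg_ne_top _).lt_top
  have fint : ∀ (n : ℕ) (ρ : Measure ℝ≥0∞) [IsFiniteMeasure ρ],
      Integrable (fun x => f x ^ n) ρ := by
    intro n ρ _
    refine Integrable.of_bound (fm.pow_const n).aestronglyMeasurable 1 (.of_forall fun x => ?_)
    rw [Real.norm_of_nonneg (pow_nonneg (f01 x).1 n)]
    exact pow_le_one₀ (f01 x).1 (f01 x).2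
  let e : BoundedContinuousFunction ℝ≥0∞ ℝ := BoundedContinuousFunction.mkOfCompact ⟨f, fc⟩
  have star_eq : ∀ a : BoundedContinuousFunction ℝ≥0∞ ℝ, star a = a := fun a => by ext x; simp
  let A : StarSubalgebra ℝ (BoundedContinuousFunction ℝ≥0∞ ℝ) :=
    { Algebra.adjoin ℝ {e} with star_mem' := fun {a} ha => (star_eq a).symm ▸ ha }
  refine ext_of_forall_mem_subalgebra_integral_eq_of_polish (𝕜 := ℝ) (A := A) ?_ ?_
  · intro x y hxy
    refine ⟨f, ⟨⟨f, fc⟩, ?_, rfl⟩, ?_⟩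
    · exact ⟨e, Algebra.subset_adjoin rfl, rfl⟩
    · intro hh
      exact hxy (strictAnti_expNeg.injective
        ((ENNReal.toReal_eq_toReal_iff' (expNeg_ne_top x) (expNeg_ne_top y)).1 hh))
  · intro g hg
    have hg' : g ∈ Algebra.adjoin ℝ {e} := hg
    rw [Algebra.adjoin_singleton_eq_range_aeval] at hg'
    obtain ⟨p, rfl⟩ := hg'
    have key : ∀ x, (Polynomial.aeval e p) x =
        ∑ i ∈ Finset.range (p.natDegree + 1), p.coeff i * f x ^ i := by
      intro x
      simp [Polynomial.aeval_eq_sum_range, e]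
    have (ρ : Measure ℝ≥0∞) [IsFiniteMeasure ρ] : ∫ x, (Polynomial.aeval e p) x ∂ρ =
        ∑ i ∈ Finset.range (p.natDegree + 1), p.coeff i * (∫⁻ x, expNeg (i * x) ∂ρ).toReal := by
      simp_rw [key]
      rw [integral_finsetSum _ fun i _ => (fint i ρ).const_mul _]
      simp_rw [integral_const_mul, fpow]
    exact (this P).trans ((by simp_rw [h]) : _ = _) |>.trans (this P').symm

/-- The Laplace transform of the Poisson distribution. -/
lemma lintegral_expNeg_poissonMeasure (r : NNReal) (s : ℝ≥0∞) :
    ∫⁻ n : ℕ, expNeg (s * n) ∂(poissonMeasure r) = expNeg (r * (1 - expNeg s)) := by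
  rw [poissonMeasure, lintegral_sum_measure]
  simp only [lintegral_smul_measure, lintegral_dirac]
  obtain ⟨y, hy0, hy1, hy⟩ : ∃ y : ℝ, 0 ≤ y ∧ y ≤ 1 ∧ expNeg s = ENNReal.ofReal y :=
    ⟨(expNeg s).toReal, by positivity,
      ENNReal.toReal_le_of_le_ofReal zero_le_one (by simpa using expNeg_le_one s),
      (ENNReal.ofReal_toReal (expNeg_ne_top s)).symm⟩
  have h1 : ∀ n : ℕ, expNeg (s * n) = ENNReal.ofReal (y ^ n) := fun n => by
    rw [mul_comm, expNeg_natCast_mul, hy, ENNReal.ofReal_pow hy0]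
  have h2 : (r : ℝ≥0∞) * (1 - expNeg s) = ENNReal.ofReal (r * (1 - y)) := by
    rw [hy, ENNReal.ofReal_mul (by positivity), ENNReal.ofReal_coe_nnreal,
      ENNReal.ofReal_sub _ hy0, ENNReal.ofReal_one]
  have h5 : 0 ≤ (r : ℝ) * (1 - y) := mul_nonneg r.2 (by linarith)
  rw [h2, expNeg_ofReal h5]
  simp_rw [h1, smul_eq_mul]
  have h3 : HasSum (fun n : ℕ => Real.exp (-r) * r ^ n / n.factorial * y ^ n)
      (Real.exp (-(r * (1 - y)))) := by
    have := (NormedSpace.expSeries_div_hasSum_exp (r * y : ℝ)).mul_left (Real.exp (-r))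
    rw [← Real.exp_eq_exp_ℝ, ← Real.exp_add] at this
    convert! this using 1
    · ext n; rw [mul_pow]; ring
    · congr 1; ring
  have h4 : ∀ n : ℕ,
      ENNReal.ofReal (Real.exp (-r) * r ^ n / n.factorial) * ENNReal.ofReal (y ^ n) =
        ENNReal.ofReal (Real.exp (-r) * r ^ n / n.factorial * y ^ n) := fun n => by
    rw [ENNReal.ofReal_mul (by positivity)]
  simp_rw [h4]
  rw [← ENNReal.ofReal_tsum_of_nonneg (fun n => by positivity) h3.summable, h3.tsum_eq]

/-! ### Laplace functionals of Poisson processes and multi-tier networks -/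

lemma ENNReal.tsum_indicator_one {ι : Type*} (s : Set ι) :
    ∑' i, s.indicator (1 : ι → ℝ≥0∞) i = (s.encard : ℝ≥0∞) := by
  rw [← ENNReal.tsum_set_one, tsum_subtype s (fun _ => (1 : ℝ≥0∞))]; rfl

lemma ENNReal.tendsto_tsum_of_monotone {ι : Type*} {f : ℕ → ι → ℝ≥0∞} {F : ι → ℝ≥0∞}
    (hm : ∀ i, Monotone fun n => f n i) (ht : ∀ i, Tendsto (fun n => f n i) atTop (𝓝 (F i))) :
    Tendsto (fun n => ∑' i, f n i) atTop (𝓝 (∑' i, F i)) := by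
  let _ : MeasurableSpace ι := ⊤
  simp_rw [← lintegral_count]
  exact lintegral_tendsto_of_tendsto_of_monotone (fun n => measurable_from_top.aemeasurable)
    (.of_forall hm) (.of_forall ht)

lemma MeasureTheory.tendsto_lintegral_expNeg {Ω : Type*} [MeasurableSpace Ω] {μ : Measure Ω}
    [IsFiniteMeasure μ] {f : ℕ → Ω → ℝ≥0∞} {F : Ω → ℝ≥0∞} (hf : ∀ n, Measurable (f n))
    (ht : ∀ ω, Tendsto (fun n => f n ω) atTop (𝓝 (F ω))) :
    Tendsto (fun n => ∫⁻ ω, expNeg (f n ω) ∂μ) atTop (𝓝 (∫⁻ ω, expNeg (F ω) ∂μ)) :=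
  tendsto_lintegral_of_dominated_convergence (fun _ => 1)
    (fun n => measurable_expNeg.comp (hf n)) (fun n => .of_forall fun ω => expNeg_le_one _)
    (by simp) (.of_forall fun ω => (continuous_expNeg.tendsto _).comp (ht ω))

/-- A function of a simple function, as a sum over the nonzero values; the value `0` is left out
because its level set may have infinite area. -/
lemma MeasureTheory.SimpleFunc.comp_eq_sum_indicator {α : Type*} [MeasurableSpace α]
    (g : SimpleFunc α ℝ≥0∞) {φ : ℝ≥0∞ → ℝ≥0∞} (hφ : φ 0 = 0) (x : α) :
    φ (g x) = ∑ y ∈ g.range.filter (· ≠ 0), φ y * (g ⁻¹' {y}).indicator 1 x := by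
  classical
  by_cases hx : g x = 0
  · rw [hx, hφ]
    refine (Finset.sum_eq_zero fun y hy => ?_).symm
    have : x ∉ g ⁻¹' {y} := fun h => (Finset.mem_filter.1 hy).2 (by rw [← hx]; exact h.symm)
    simp [this]
  · rw [Finset.sum_eq_single (g x)]
    · simp
    · intro y _ hne
      have : x ∉ g ⁻¹' {y} := fun h => hne h.symm
      simp [this]
    · intro h
      exact absurd (Finset.mem_filter.2 ⟨g.mem_range_self x, hx⟩) h

section
variable {Ω : Type*} [MeasurableSpace Ω] {μ : Measure Ω} [IsProbabilityMeasure μ]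

lemma measurable_pointCount {X : ℕ → Ω → Plane} (hX : ∀ k, Measurable (X k)) {A : Set Plane}
    (hA : MeasurableSet A) : Measurable (pointCount X A) :=
  measurable_encard.comp (measurable_set_iff.2 fun k =>
    (measurable_mem.2 hA).comp (hX k) )

lemma measurable_eval_pair (k : ℕ) : Measurable
    fun z : (ℕ → Plane) × (ℕ → ℝ × ℝ) => (z.1 k, z.2 k) := by
  fun_prop

namespace IsPoissonProcess
variable {lam : ℝ} {X : ℕ → Ω → Plane}

lemma map_pointCount (h : IsPoissonProcess μ lam X) {A : Set Plane} (hA : MeasurableSet A)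
    (hv : volume A ≠ ∞) :
    μ.map (pointCount X A) =
      (poissonMeasure (lam * volume.real A).toNNReal).map (Nat.cast : ℕ → ℕ∞) := by
  have hm := measurable_pointCount h.measurable hA
  have : IsProbabilityMeasure (μ.map (pointCount X A)) :=
    Measure.isProbabilityMeasure_map hm.aemeasurable
  have : IsProbabilityMeasure
      ((poissonMeasure (lam * volume.real A).toNNReal).map (Nat.cast : ℕ → ℕ∞)) :=
    Measure.isProbabilityMeasure_map Measurable.of_discrete.aemeasurable
  symm
  refine Measure.eq_of_le_of_isProbabilityMeasure (Measure.le_iff.2 fun s hs => ?_)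
  have hdisj : s.PairwiseDisjoint fun a : ℕ∞ => ({a} : Set ℕ∞) := by
    simp +contextual [Set.pairwiseDisjoint_iff]
  rw [← s.biUnion_of_singleton, measure_biUnion s.to_countable hdisj (by simp),
    measure_biUnion s.to_countable hdisj (by simp)]
  refine ENNReal.tsum_le_tsum fun a => ?_
  obtain ⟨a, ha⟩ := a
  rw [Measure.map_apply Measurable.of_discrete (by simp), Measure.map_apply hm (by simp)]
  induction a using ENat.recTopCoe with
  | top => simp [Set.preimage]
  | coe n =>
    have h1 : (Nat.cast : ℕ → ℕ∞) ⁻¹' {(n : ℕ∞)} = {n} := by ext; simp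
    rw [h1, ← h.law A hA hv n]
    rfl

lemma lintegral_expNeg_pointCount (h : IsPoissonProcess μ lam X) (hl : 0 ≤ lam) {A : Set Plane}
    (hA : MeasurableSet A) (hv : volume A ≠ ∞) (s : ℝ≥0∞) :
    ∫⁻ ω, expNeg (s * pointCount X A ω) ∂μ =
      expNeg (ENNReal.ofReal lam * ((1 - expNeg s) * volume A)) := by
  have e1 : ∫⁻ ω, expNeg (s * pointCount X A ω) ∂μ =
      ∫⁻ n, expNeg (s * (n : ℕ∞)) ∂(μ.map (pointCount X A)) :=
    (lintegral_map (f := fun n : ℕ∞ => expNeg (s * (n : ℝ≥0∞))) Measurable.of_discrete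
      (measurable_pointCount h.measurable hA)).symm
  rw [e1, h.map_pointCount hA hv, lintegral_map Measurable.of_discrete Measurable.of_discrete]
  simp only [ENat.toENNReal_coe]
  rw [lintegral_expNeg_poissonMeasure]
  congr 1
  have : ((lam * volume.real A).toNNReal : ℝ≥0∞) = ENNReal.ofReal lam * volume A := by
    change ENNReal.ofReal _ = _
    rw [ENNReal.ofReal_mul hl, ofReal_measureReal hv]
  rw [this, mul_assoc, mul_comm (volume A)]

lemma lintegral_expNeg_tsum_simpleFunc (h : IsPoissonProcess μ lam X) (hl : 0 ≤ lam)
    (g : SimpleFunc Plane ℝ≥0∞) (hg : ∀ y ≠ 0, volume (g ⁻¹' {y}) ≠ ∞) :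
    ∫⁻ ω, expNeg (∑' k, g (X k ω)) ∂μ =
      expNeg (ENNReal.ofReal lam * ∫⁻ x, (1 - expNeg (g x))) := by
  classical
  set R := g.range.filter (· ≠ 0)
  have hR : ∀ y ∈ R, y ≠ 0 := fun y hy => (Finset.mem_filter.1 hy).2
  have e1 : ∀ ω, ∑' k, g (X k ω) = ∑ y ∈ R, y * (pointCount X (g ⁻¹' {y}) ω : ℝ≥0∞) := by
    intro ω
    have : ∀ k, g (X k ω) = ∑ y ∈ R, y * (g ⁻¹' {y}).indicator 1 (X k ω) := fun k =>
      g.comp_eq_sum_indicator (φ := id) rfl _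
    simp_rw [this]
    rw [Summable.tsum_finsetSum fun _ _ => ENNReal.summable]
    refine Finset.sum_congr rfl fun y _ => ?_
    rw [ENNReal.tsum_mul_left]
    congr 1
    exact ENNReal.tsum_indicator_one {k | X k ω ∈ g ⁻¹' {y}}
  have e2 : ∫⁻ x, (1 - expNeg (g x)) = ∑ y ∈ R, (1 - expNeg y) * volume (g ⁻¹' {y}) := by
    have : ∀ x, 1 - expNeg (g x) = ∑ y ∈ R, (1 - expNeg y) * (g ⁻¹' {y}).indicator 1 x := fun x =>
      g.comp_eq_sum_indicator (φ := fun y => 1 - expNeg y) (by simp [expNeg_zero]) _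
    simp_rw [this]
    rw [lintegral_finsetSum]
    · refine Finset.sum_congr rfl fun y _ => ?_
      rw [lintegral_const_mul _ (measurable_one.indicator (g.measurableSet_fiber y)),
        lintegral_indicator_one (g.measurableSet_fiber y)]
    · exact fun y _ => (measurable_one.indicator (g.measurableSet_fiber y)).const_mul _
  rw [e2, Finset.mul_sum, expNeg_sum]
  simp_rw [e1, expNeg_sum]
  -- the definition indexes disjoint sets by `Fin r`
  set q := R.equivFin
  have ind := h.indep R.card (fun i => g ⁻¹' {(q.symm i : ℝ≥0∞)})
    (fun i => g.measurableSet_fiber _) (fun i => hg _ (hR _ (q.symm i).2)) (by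
      intro i j hij
      refine Set.disjoint_left.2 fun x hx hx' => hij ?_
      exact q.symm.injective (Subtype.ext (hx.symm.trans hx')))
  have ind2 := ind.comp (fun i (n : ℕ∞) => expNeg ((q.symm i : ℝ≥0∞) * n))
    (fun i => Measurable.of_discrete)
  have conv : ∀ F : ℝ≥0∞ → ℝ≥0∞, ∏ y ∈ R, F y = ∏ i, F (q.symm i : ℝ≥0∞) := fun F => by
    rw [← Finset.prod_coe_sort, ← q.symm.prod_comp]
  simp_rw [conv]
  have := lintegral_prod_eq_prod_lintegral_of_indepFun Finset.univ _ ind2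
    (fun i => Measurable.of_discrete.comp
      (measurable_pointCount h.measurable (g.measurableSet_fiber _)))
  simp only [Function.comp_apply] at this
  rw [this]
  exact Finset.prod_congr rfl fun i _ =>
    h.lintegral_expNeg_pointCount hl (g.measurableSet_fiber _) (hg _ (hR _ (q.symm i).2)) _

/-- The Laplace functional of a homogeneous Poisson process. No integrability of `g` is needed, as
both sides vanish if `1 - exp (-g)` is not integrable. -/
theorem lintegral_expNeg_tsum (h : IsPoissonProcess μ lam X) (hl : 0 ≤ lam)
    {g : Plane → ℝ≥0∞} (hg : Measurable g) :
    ∫⁻ ω, expNeg (∑' k, g (X k ω)) ∂μ =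
      expNeg (ENNReal.ofReal lam * ∫⁻ x, (1 - expNeg (g x))) := by
  -- the level sets of simple functions supported in balls have finite area
  let a : ℕ → SimpleFunc Plane ℝ≥0∞ := fun n =>
    (SimpleFunc.eapprox g n).restrict (Metric.ball 0 n)
  have ha : ∀ n x, a n x = (Metric.ball 0 n).indicator (SimpleFunc.eapprox g n) x := fun n x =>
    SimpleFunc.restrict_apply _ measurableSet_ball x
  have am : ∀ x, Monotone fun n => a n x := by
    intro x i j hij
    simp only [ha]
    refine (Set.indicator_le_indicator_of_subset (Metric.ball_subset_ball (by exact_mod_cast hij))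
      (fun _ => bot_le) x).trans (Set.indicator_le_indicator ?_)
    exact SimpleFunc.monotone_eapprox g hij x
  have at' : ∀ x, Tendsto (fun n => a n x) atTop (𝓝 (g x)) := by
    intro x
    refine (SimpleFunc.tendsto_eapprox hg x).congr' ?_
    obtain ⟨N, hN⟩ := exists_nat_gt ‖x‖
    filter_upwards [eventually_ge_atTop N] with n hn
    rw [ha, Set.indicator_of_mem]
    rw [mem_ball_zero_iff]
    exact hN.trans_le (by exact_mod_cast hn)
  have av : ∀ n, ∀ y ≠ 0, volume (a n ⁻¹' {y}) ≠ ∞ := by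
    intro n y hy
    refine ((measure_mono ?_).trans_lt (measure_ball_lt_top (x := (0 : Plane)) (r := n))).ne
    intro x hx
    by_contra hxb
    refine hy ?_
    have : a n x = y := hx
    rw [← this, ha, Set.indicator_of_notMem hxb]
  have l1 := tendsto_lintegral_expNeg (μ := μ)
    (fun n => Measurable.tsum fun k => (a n).measurable.comp (h.measurable k))
    (fun ω => ENNReal.tendsto_tsum_of_monotone (fun k => am (X k ω)) (fun k => at' (X k ω)))
  have l2 : Tendsto (fun n => ∫⁻ x, (1 - expNeg (a n x))) atTop
      (𝓝 (∫⁻ x, (1 - expNeg (g x)))) := by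
    refine lintegral_tendsto_of_tendsto_of_monotone (fun n => ?_) (.of_forall fun x => ?_)
      (.of_forall fun x => ?_)
    · exact (measurable_const.sub (measurable_expNeg.comp (a n).measurable)).aemeasurable
    · exact fun i j hij => tsub_le_tsub_left (strictAnti_expNeg.antitone (am x hij)) 1
    · exact ENNReal.Tendsto.sub tendsto_const_nhds ((continuous_expNeg.tendsto _).comp (at' x))
        (Or.inl ENNReal.one_ne_top)
  refine tendsto_nhds_unique l1 ?_
  simp only [Function.comp_apply]
  simp_rw [fun n => h.lintegral_expNeg_tsum_simpleFunc hl (a n) (av n)]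
  exact (continuous_expNeg.tendsto _).comp
    (ENNReal.Tendsto.const_mul l2 (Or.inr ENNReal.ofReal_ne_top))

end IsPoissonProcess

namespace IsMarkedPoissonProcess
variable {lam : ℝ} {ν : Measure (ℝ × ℝ)} {X : ℕ → Ω → Plane} {Q : ℕ → Ω → ℝ × ℝ}

lemma isProbabilityMeasure (h : IsMarkedPoissonProcess μ lam ν X Q) : IsProbabilityMeasure ν := by
  rw [← h.law_mark 0]
  exact Measure.isProbabilityMeasure_map (h.measurable_mark 0).aemeasurable

/-- In the expectation of a finite product, the marks may be integrated out. -/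
lemma lintegral_prod_marks (h : IsMarkedPoissonProcess μ lam ν X Q)
    {f : Plane → ℝ × ℝ → ℝ≥0∞} (hf : Measurable (Function.uncurry f)) (n : ℕ) :
    ∫⁻ ω, ∏ k ∈ Finset.range n, f (X k ω) (Q k ω) ∂μ =
      ∫⁻ ω, ∏ k ∈ Finset.range n, ∫⁻ q, f (X k ω) q ∂ν ∂μ := by
  have mX : Measurable fun ω k => X k ω := measurable_pi_lambda _ h.poisson.measurable
  have mQ : Measurable fun ω k => Q k ω := measurable_pi_lambda _ h.measurable_mark
  have law := (indepFun_iff_map_prod_eq_prod_map_map mX.aemeasurable mQ.aemeasurable).1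
    h.indep_points_marks
  have mF : Measurable fun z : (ℕ → Plane) × (ℕ → ℝ × ℝ) =>
      ∏ k ∈ Finset.range n, f (z.1 k) (z.2 k) :=
    Finset.measurable_fun_prod _ fun k _ => hf.comp (measurable_eval_pair k)
  calc _ = ∫⁻ z, ∏ k ∈ Finset.range n, f (z.1 k) (z.2 k)
        ∂(μ.map fun ω => ((fun k => X k ω), (fun k => Q k ω))) :=
      (lintegral_map mF (mX.prodMk mQ)).symm
    _ = ∫⁻ ω, ∫⁻ ω', ∏ k ∈ Finset.range n, f (X k ω) (Q k ω') ∂μ ∂μ := by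
      rw [law, lintegral_prod _ mF.aemeasurable, lintegral_map mF.lintegral_prod_right' mX]
      exact lintegral_congr fun ω => lintegral_map (mF.comp measurable_prodMk_left) mQ
    _ = _ := by
      refine lintegral_congr fun ω => ?_
      have mk : ∀ k, Measurable (f (X k ω)) := fun k => hf.comp measurable_prodMk_left
      have := lintegral_prod_eq_prod_lintegral_of_indepFun (Finset.range n) _
        (h.indep_mark.comp (fun k => f (X k ω)) mk) (fun k => (mk k).comp (h.measurable_mark k))
      refine this.trans (Finset.prod_congr rfl fun k _ => ?_)
      rw [← h.law_mark k, lintegral_map (mk k) (h.measurable_mark k)]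
      rfl

/-- The Laplace functional of an independently marked Poisson process. -/
theorem lintegral_expNeg_tsum (h : IsMarkedPoissonProcess μ lam ν X Q) (hl : 0 ≤ lam)
    {g : Plane → ℝ × ℝ → ℝ≥0∞} (hg : Measurable (Function.uncurry g)) :
    ∫⁻ ω, expNeg (∑' k, g (X k ω) (Q k ω)) ∂μ =
      expNeg (ENNReal.ofReal lam * ∫⁻ x, ∫⁻ q, (1 - expNeg (g x q)) ∂ν) := by
  have := h.isProbabilityMeasure
  set G : Plane → ℝ≥0∞ := fun x => negLog (∫⁻ q, expNeg (g x q) ∂ν)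
  have mG : Measurable G :=
    measurable_negLog.comp (measurable_expNeg.comp hg).lintegral_prod_right'
  have eG : ∀ x, expNeg (G x) = ∫⁻ q, expNeg (g x q) ∂ν := fun x => by
    refine expNeg_negLog ((lintegral_mono fun q => expNeg_le_one _).trans ?_)
    simp
  have mX : ∀ k, Measurable fun ω => g (X k ω) (Q k ω) := fun k =>
    hg.comp ((h.poisson.measurable k).prodMk (h.measurable_mark k))
  have l1 := tendsto_lintegral_expNeg (μ := μ)
    (fun n => Finset.measurable_fun_sum (Finset.range n) fun k _ => mX k)
    (fun ω => ENNReal.tendsto_nat_tsum fun k => g (X k ω) (Q k ω))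
  have l2 := tendsto_lintegral_expNeg (μ := μ)
    (fun n => Finset.measurable_fun_sum (Finset.range n) fun k _ =>
      mG.comp (h.poisson.measurable k))
    (fun ω => ENNReal.tendsto_nat_tsum fun k => G (X k ω))
  simp only [expNeg_sum, Function.comp_apply] at l1 l2
  simp_rw [h.lintegral_prod_marks (f := fun x q => expNeg (g x q)) (measurable_expNeg.comp hg),
    ← eG] at l1
  rw [tendsto_nhds_unique l1 l2, h.poisson.lintegral_expNeg_tsum hl mG]
  congr 3
  ext x
  have mx : Measurable fun q => expNeg (g x q) :=
    measurable_expNeg.comp (hg.comp measurable_prodMk_left)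
  have hle : ∫⁻ q, expNeg (g x q) ∂ν ≤ 1 :=
    (lintegral_mono fun q => expNeg_le_one _).trans (by simp)
  rw [lintegral_sub mx (hle.trans_lt ENNReal.one_lt_top).ne (.of_forall fun q => expNeg_le_one _),
    eG]
  simp

end IsMarkedPoissonProcess

/-- The Laplace functional of the superposition of the tiers. -/
theorem IsMultiTierNetwork.lintegral_expNeg_tsum {m : ℕ} {lam : Fin m → ℝ}
    {ν : Fin m → Measure (ℝ × ℝ)} {X : Fin m → ℕ → Ω → Plane} {Q : Fin m → ℕ → Ω → ℝ × ℝ}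
    (h : IsMultiTierNetwork μ lam ν X Q) (hl : ∀ j, 0 ≤ lam j)
    {g : Fin m → Plane → ℝ × ℝ → ℝ≥0∞} (hg : ∀ j, Measurable (Function.uncurry (g j))) :
    ∫⁻ ω, expNeg (∑' p : Fin m × ℕ, g p.1 (X p.1 p.2 ω) (Q p.1 p.2 ω)) ∂μ =
      expNeg (∑ j, ENNReal.ofReal (lam j) * ∫⁻ x, ∫⁻ q, (1 - expNeg (g j x q)) ∂(ν j)) := by
  have e1 : ∀ ω, ∑' p : Fin m × ℕ, g p.1 (X p.1 p.2 ω) (Q p.1 p.2 ω) =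
      ∑ j, ∑' k, g j (X j k ω) (Q j k ω) := fun ω => by
    rw [ENNReal.tsum_prod', tsum_fintype]
  simp_rw [e1, expNeg_sum]
  have mΨ : ∀ j, Measurable fun z : (ℕ → Plane) × (ℕ → ℝ × ℝ) =>
      expNeg (∑' k, g j (z.1 k) (z.2 k)) := fun j =>
    measurable_expNeg.comp (Measurable.tsum fun k => (hg j).comp (measurable_eval_pair k))
  have ind := h.indep_tiers.comp _ mΨ
  have := lintegral_prod_eq_prod_lintegral_of_indepFun Finset.univ _ ind (fun j => (mΨ j).comp
    ((measurable_pi_lambda _ (h.tier j).poisson.measurable).prodMk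
      (measurable_pi_lambda _ (h.tier j).measurable_mark)))
  simp only [Function.comp_apply] at this
  rw [this]
  exact Finset.prod_congr rfl fun j _ => (h.tier j).lintegral_expNeg_tsum (hl j) (hg j)
end

/-! ### The process of received powers -/

/-- The power received at the origin from a station at `u` with `P S = 1`. -/
noncomputable def unitPower (K β : ℝ) (u : Plane) : ℝ≥0∞ := ENNReal.ofReal (pathLoss K β ‖u‖)⁻¹

lemma measurable_unitPower (K β : ℝ) : Measurable (unitPower K β) := by
  unfold unitPower pathLoss; fun_prop

lemma measurable_ofReal_propagationLoss_inv (K β : ℝ) :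
    Measurable fun z : Plane × (ℝ × ℝ) => ENNReal.ofReal (propagationLoss K β z.1 z.2)⁻¹ := by
  unfold propagationLoss pathLoss; fun_prop

lemma ofReal_propagationLoss_inv_eq_unitPower {K β : ℝ} (hK : 0 < K) (hβ : 0 < β) {q : ℝ × ℝ}
    (hq : 0 < q.2 * q.1) (x : Plane) :
    ENNReal.ofReal (propagationLoss K β x q)⁻¹ =
      unitPower K β (((q.2 * q.1) ^ (1 / β))⁻¹ • x) := by
  have hr : 0 < (q.2 * q.1) ^ (1 / β) := Real.rpow_pos_of_pos hq _
  rw [unitPower, propagationLoss, pathLoss, pathLoss, norm_smul, norm_inv,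
    Real.norm_of_nonneg hr.le, mul_left_comm, Real.mul_rpow (inv_nonneg.2 hr.le) (by positivity),
    Real.inv_rpow hr.le,
    ← Real.rpow_mul hq.le, one_div_mul_cancel hβ.ne', Real.rpow_one, inv_mul_eq_div]

/-- Scaling: a mark `q = (S, P)` affects the intensity of the received powers only through the
factor `(P S) ^ (2 / β)`. -/
lemma lintegral_propagationLoss_inv {K β : ℝ} (hK : 0 < K) (hβ : 0 < β) {q : ℝ × ℝ}
    (hq : 0 < q.2 * q.1) {F : ℝ≥0∞ → ℝ≥0∞} (hF : Measurable F) :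
    ∫⁻ x, F (ENNReal.ofReal (propagationLoss K β x q)⁻¹) =
      ENNReal.ofReal ((q.2 * q.1) ^ (2 / β)) * ∫⁻ u, F (unitPower K β u) := by
  set r := (q.2 * q.1) ^ (1 / β) with hr
  have hr0 : 0 < r := Real.rpow_pos_of_pos hq _
  simp_rw [ofReal_propagationLoss_inv_eq_unitPower hK hβ hq, ← hr]
  have mF : Measurable fun u => F (unitPower K β u) := hF.comp (measurable_unitPower K β)
  rw [← lintegral_map (g := fun x : Plane => r⁻¹ • x) mF (measurable_const_smul _),
    Measure.map_addHaar_smul _ (inv_ne_zero hr0.ne'), lintegral_smul_measure, smul_eq_mul]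
  congr 2
  rw [finrank_euclideanSpace_fin, inv_pow, inv_inv, abs_of_nonneg (by positivity), hr,
    ← Real.rpow_natCast, ← Real.rpow_mul hq.le]
  congr 1
  push_cast; ring

section
variable {Ω : Type*} [MeasurableSpace Ω] {μ : Measure Ω} {m : ℕ}
  {lam : Fin m → ℝ} {ν : Fin m → Measure (ℝ × ℝ)} {X : Fin m → ℕ → Ω → Plane}
  {Q : Fin m → ℕ → Ω → ℝ × ℝ} {K β : ℝ}

namespace IsMultiTierNetwork

lemma measurable_receivedPower (h : IsMultiTierNetwork μ lam ν X Q) (p : Fin m × ℕ) :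
    Measurable (receivedPower K β X Q p) := by
  obtain ⟨j, k⟩ := p
  have hX : Measurable (X j k) := (h.tier j).poisson.measurable k
  have hQ : Measurable (Q j k) := (h.tier j).measurable_mark k
  have := (measurable_ofReal_propagationLoss_inv K β).comp (hX.prodMk hQ)
  exact this

lemma measurable_totalPower (h : IsMultiTierNetwork μ lam ν X Q) :
    Measurable (totalPower K β X Q) := by
  unfold totalPower
  exact Measurable.tsum fun p => h.measurable_receivedPower p

/-- The Laplace functional of the received powers, labelled by the tiers: their intensity measure
is the product of the measure with weights `λ*_j` on the tiers and the image of Lebesgue measure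
under `unitPower`. -/
theorem lintegral_expNeg_tsum_receivedPower [IsProbabilityMeasure μ]
    (h : IsMultiTierNetwork μ lam ν X Q) (hK : 0 < K)
    (hβ : 0 < β) (hl : ∀ j, 0 ≤ lam j) (hν : ∀ j, ∀ᵐ q ∂(ν j), 0 < q.1 ∧ 0 < q.2)
    (hmom : ∀ j, Integrable (fun q : ℝ × ℝ => (q.2 * q.1) ^ (2 / β)) (ν j))
    {g : Fin m → ℝ≥0∞ → ℝ≥0∞} (hg : ∀ j, Measurable (g j)) :
    ∫⁻ ω, expNeg (∑' p : Fin m × ℕ, g p.1 (receivedPower K β X Q p ω)) ∂μ =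
      expNeg (∫⁻ u, ∑ j, ENNReal.ofReal (effectiveDensity β (lam j) (ν j)) *
        (1 - expNeg (g j (unitPower K β u)))) := by
  have mg : ∀ j, Measurable fun v => 1 - expNeg (g j v) := fun j =>
    measurable_const.sub (measurable_expNeg.comp (hg j))
  have mu : ∀ j, Measurable fun u => 1 - expNeg (g j (unitPower K β u)) := fun j =>
    (mg j).comp (measurable_unitPower K β)
  have := h.lintegral_expNeg_tsum hl
    (g := fun j x q => g j (ENNReal.ofReal (propagationLoss K β x q)⁻¹))
    (fun j => (hg j).comp (measurable_ofReal_propagationLoss_inv K β))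
  refine this.trans ?_
  rw [lintegral_finsetSum _ fun j _ => (mu j).const_mul _]
  congr 1
  refine Finset.sum_congr rfl fun j _ => ?_
  have := (h.tier j).isProbabilityMeasure
  have mv : Measurable (Function.uncurry fun (x : Plane) (q : ℝ × ℝ) =>
      1 - expNeg (g j (ENNReal.ofReal (propagationLoss K β x q)⁻¹))) :=
    (mg j).comp (measurable_ofReal_propagationLoss_inv K β)
  rw [lintegral_lintegral_swap mv.aemeasurable]
  have e1 : ∫⁻ q, (∫⁻ x, 1 - expNeg (g j (ENNReal.ofReal (propagationLoss K β x q)⁻¹))) ∂(ν j) =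
      ∫⁻ q, (ENNReal.ofReal ((q.2 * q.1) ^ (2 / β)) *
        ∫⁻ u, (1 - expNeg (g j (unitPower K β u)))) ∂(ν j) := by
    refine lintegral_congr_ae ?_
    filter_upwards [hν j] with q hq
    exact lintegral_propagationLoss_inv hK hβ (mul_pos hq.2 hq.1) (mg j)
  have mpow : Measurable fun q : ℝ × ℝ => ENNReal.ofReal ((q.2 * q.1) ^ (2 / β)) := by fun_prop
  rw [e1, lintegral_mul_const _ mpow, lintegral_const_mul _ (mu j),
    ← ofReal_integral_eq_lintegral_ofReal (hmom j), ← mul_assoc, ← ENNReal.ofReal_mul (hl j)]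
  · rfl
  · filter_upwards [hν j] with q hq
    exact Real.rpow_nonneg (mul_pos hq.2 hq.1).le _

end IsMultiTierNetwork
end

/-! ### Independence of the tier labels -/

/-- The average of `g` over a tier drawn with probabilities `w`, on the scale of `exp (-g)`. -/
noncomputable def tierAverage {m : ℕ} (w g : Fin m → ℝ≥0∞) : ℝ≥0∞ :=
  negLog (∑ j, w j * expNeg (g j))

section
variable {m : ℕ} {w : Fin m → ℝ≥0∞}

lemma expNeg_tierAverage (hw : ∑ j, w j = 1) (g : Fin m → ℝ≥0∞) :
    expNeg (tierAverage w g) = ∑ j, w j * expNeg (g j) := by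
  refine expNeg_negLog ?_
  rw [← hw]
  exact Finset.sum_le_sum fun j _ => mul_le_of_le_one_right' (expNeg_le_one _)

lemma monotone_tierAverage (w : Fin m → ℝ≥0∞) : Monotone (tierAverage w) := fun _ _ h =>
  antitone_negLog (Finset.sum_le_sum fun j _ =>
    mul_le_mul_right (strictAnti_expNeg.antitone (h j)) _)

lemma continuous_tierAverage (hw : ∑ j, w j = 1) : Continuous (tierAverage w) := by
  refine continuous_negLog.comp (continuous_finsetSum _ fun j _ => ?_)
  have hj : w j ≠ ∞ := ((Finset.single_le_sum (fun i _ => bot_le) (Finset.mem_univ j)).trans_lt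
    (hw.trans_lt ENNReal.one_lt_top)).ne
  exact (ENNReal.continuous_const_mul hj).comp (continuous_expNeg.comp (continuous_apply j))

variable {Ω : Type*} [MeasurableSpace Ω] {μ : Measure Ω} [IsProbabilityMeasure μ]
  {lam : Fin m → ℝ} {ν : Fin m → Measure (ℝ × ℝ)} {X : Fin m → ℕ → Ω → Plane}
  {Q : Fin m → ℕ → Ω → ℝ × ℝ} {K β : ℝ} {Λ : ℝ≥0∞}

namespace IsMultiTierNetwork

/-- A Laplace functional does not change when the tier label of each station is replaced by an
independent one with law `w`, since `∑ λ*_j exp (-g_j) = ∑ λ*_j exp (-b)`. -/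
lemma lintegral_expNeg_eq_of_average (h : IsMultiTierNetwork μ lam ν X Q) (hK : 0 < K)
    (hβ : 0 < β) (hl : ∀ j, 0 ≤ lam j) (hν : ∀ j, ∀ᵐ q ∂(ν j), 0 < q.1 ∧ 0 < q.2)
    (hmom : ∀ j, Integrable (fun q : ℝ × ℝ => (q.2 * q.1) ^ (2 / β)) (ν j))
    (hw : ∑ j, w j = 1)
    (hΛ : ∀ j, ENNReal.ofReal (effectiveDensity β (lam j) (ν j)) = Λ * w j)
    {g : Fin m → ℝ≥0∞ → ℝ≥0∞} (hg : ∀ j, Measurable (g j)) {b : ℝ≥0∞ → ℝ≥0∞} (hb : Measurable b)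
    (hbg : ∀ v, expNeg (b v) = ∑ j, w j * expNeg (g j v)) :
    ∫⁻ ω, expNeg (∑' p : Fin m × ℕ, g p.1 (receivedPower K β X Q p ω)) ∂μ =
      ∫⁻ ω, expNeg (∑' p : Fin m × ℕ, b (receivedPower K β X Q p ω)) ∂μ := by
  rw [h.lintegral_expNeg_tsum_receivedPower hK hβ hl hν hmom hg,
    h.lintegral_expNeg_tsum_receivedPower hK hβ hl hν hmom (g := fun _ => b) (fun _ => hb)]
  congr 1
  refine lintegral_congr fun u => ?_
  simp_rw [hΛ, mul_assoc, ← Finset.mul_sum]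
  congr 1
  have hfin : ∑ j, w j * expNeg (g j (unitPower K β u)) ≠ ∞ := by
    rw [← hbg]; exact expNeg_ne_top _
  have aux : ∀ x : ℝ≥0∞, 1 - expNeg x + expNeg x = 1 := fun x =>
    tsub_add_cancel_of_le (expNeg_le_one x)
  rw [← ENNReal.add_left_inj hfin]
  conv_rhs => rw [← hbg]
  rw [← Finset.sum_add_distrib, ← Finset.sum_mul, hw, one_mul, aux]
  simp_rw [← mul_add, aux, mul_one, hw]

/-- The tier labels are independent of the received powers even in the presence of a function of
the total power: adding `n * v` to `g j v` multiplies the functional by `exp (-n I)`, and these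
factors determine the law of the total power `I` under the weighted measures. -/
lemma lintegral_expNeg_mul_eq_of_average (h : IsMultiTierNetwork μ lam ν X Q) (hK : 0 < K)
    (hβ : 0 < β) (hl : ∀ j, 0 ≤ lam j) (hν : ∀ j, ∀ᵐ q ∂(ν j), 0 < q.1 ∧ 0 < q.2)
    (hmom : ∀ j, Integrable (fun q : ℝ × ℝ => (q.2 * q.1) ^ (2 / β)) (ν j))
    (hw : ∑ j, w j = 1)
    (hΛ : ∀ j, ENNReal.ofReal (effectiveDensity β (lam j) (ν j)) = Λ * w j)
    {g : Fin m → ℝ≥0∞ → ℝ≥0∞} (hg : ∀ j, Measurable (g j)) {b : ℝ≥0∞ → ℝ≥0∞} (hb : Measurable b)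
    (hbg : ∀ v, expNeg (b v) = ∑ j, w j * expNeg (g j v)) {φ : ℝ≥0∞ → ℝ≥0∞} (hφ : Measurable φ) :
    ∫⁻ ω, expNeg (∑' p : Fin m × ℕ, g p.1 (receivedPower K β X Q p ω)) *
        φ (totalPower K β X Q ω) ∂μ =
      ∫⁻ ω, expNeg (∑' p : Fin m × ℕ, b (receivedPower K β X Q p ω)) *
        φ (totalPower K β X Q ω) ∂μ := by
  have mI : Measurable (totalPower K β X Q) := h.measurable_totalPower
  have mS : ∀ {f : Fin m → ℝ≥0∞ → ℝ≥0∞}, (∀ j, Measurable (f j)) → Measurable fun ω =>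
      expNeg (∑' p : Fin m × ℕ, f p.1 (receivedPower K β X Q p ω)) := fun hf =>
    measurable_expNeg.comp (Measurable.tsum fun p => (hf p.1).comp (h.measurable_receivedPower p))
  -- the law of the total power, weighted by the functional
  let P : (Fin m → ℝ≥0∞ → ℝ≥0∞) → Measure ℝ≥0∞ := fun f =>
    (μ.withDensity fun ω => expNeg (∑' p : Fin m × ℕ, f p.1 (receivedPower K β X Q p ω))).map
      (totalPower K β X Q)
  have hP : ∀ {f : Fin m → ℝ≥0∞ → ℝ≥0∞}, (∀ j, Measurable (f j)) → ∀ {φ : ℝ≥0∞ → ℝ≥0∞},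
      Measurable φ → ∫⁻ x, φ x ∂(P f) =
        ∫⁻ ω, expNeg (∑' p : Fin m × ℕ, f p.1 (receivedPower K β X Q p ω)) *
          φ (totalPower K β X Q ω) ∂μ := fun {f} hf {φ} hφ => by
    rw [lintegral_map hφ mI]
    exact lintegral_withDensity_eq_lintegral_mul _ (mS hf) (hφ.comp mI)
  have fin : ∀ f, IsFiniteMeasure (P f) := fun f => by
    have : IsFiniteMeasure (μ.withDensity fun ω =>
        expNeg (∑' p : Fin m × ℕ, f p.1 (receivedPower K β X Q p ω))) :=
      isFiniteMeasure_withDensity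
        (((lintegral_mono fun ω => expNeg_le_one _).trans (by simp)).trans_lt ENNReal.one_lt_top).ne
    infer_instance
  have key : P g = P fun _ => b := by
    have := fin g
    have := fin fun _ => b
    refine Measure.ext_of_lintegral_expNeg fun n => ?_
    have mn : Measurable fun x : ℝ≥0∞ => (n : ℝ≥0∞) * x := measurable_id.const_mul _
    have comb : ∀ (f : Fin m → ℝ≥0∞ → ℝ≥0∞) (ω : Ω),
        expNeg (∑' p : Fin m × ℕ, f p.1 (receivedPower K β X Q p ω)) *
          expNeg (n * totalPower K β X Q ω) =
        expNeg (∑' p : Fin m × ℕ, (f p.1 (receivedPower K β X Q p ω) +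
          n * receivedPower K β X Q p ω)) := fun f ω => by
      rw [← expNeg_add, totalPower, ← ENNReal.tsum_mul_left, ← ENNReal.tsum_add]
    have me : Measurable fun x : ℝ≥0∞ => expNeg (n * x) := measurable_expNeg.comp mn
    rw [hP hg me, hP (fun _ => hb) me]
    refine (lintegral_congr (comb g)).trans
      (Eq.trans ?_ (lintegral_congr (comb fun _ => b)).symm)
    refine h.lintegral_expNeg_eq_of_average hK hβ hl hν hmom hw hΛ
      (g := fun j v => g j v + n * v) (b := fun v => b v + n * v)
      (fun j => (hg j).add mn) (hb.add mn) fun v => ?_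
    simp_rw [expNeg_add, hbg, Finset.sum_mul, mul_assoc]
  rw [← hP hg hφ, ← hP (fun _ => hb) hφ, key]

/-- The averaging over the tier labels for functionals that depend on the total power `I`. As `g`
is decreasing and right-continuous in `I`, it suffices to let `I` take finitely many values and to
pass to the limit from the right. -/
theorem lintegral_expNeg_tsum_eq_tierAverage (h : IsMultiTierNetwork μ lam ν X Q) (hK : 0 < K)
    (hβ : 0 < β) (hl : ∀ j, 0 ≤ lam j) (hν : ∀ j, ∀ᵐ q ∂(ν j), 0 < q.1 ∧ 0 < q.2)
    (hmom : ∀ j, Integrable (fun q : ℝ × ℝ => (q.2 * q.1) ^ (2 / β)) (ν j))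
    (hw : ∑ j, w j = 1)
    (hΛ : ∀ j, ENNReal.ofReal (effectiveDensity β (lam j) (ν j)) = Λ * w j)
    {g : Fin m → ℝ≥0∞ → ℝ≥0∞ → ℝ≥0∞} (hg : ∀ j r, Measurable (g j r))
    (ganti : ∀ j v, Antitone fun r => g j r v)
    (gcont : ∀ j v (u : ℕ → ℝ≥0∞) (r : ℝ≥0∞), (∀ n, r ≤ u n) → Tendsto u atTop (𝓝 r) →
      Tendsto (fun n => g j (u n) v) atTop (𝓝 (g j r v))) :
    ∫⁻ ω, expNeg (∑' p : Fin m × ℕ,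
        g p.1 (totalPower K β X Q ω) (receivedPower K β X Q p ω)) ∂μ =
      ∫⁻ ω, expNeg (∑' p : Fin m × ℕ, tierAverage w fun j =>
        g j (totalPower K β X Q ω) (receivedPower K β X Q p ω)) ∂μ := by
  classical
  have mI : Measurable (totalPower K β X Q) := h.measurable_totalPower
  have mV : ∀ p, Measurable (receivedPower K β X Q p) := h.measurable_receivedPower
  have mb : ∀ r, Measurable fun v => tierAverage w fun j => g j r v := fun r =>
    (continuous_tierAverage hw).measurable.comp (measurable_pi_lambda _ fun j => hg j r)
  -- `ρ n` is a simple function, and decreases to the identity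
  let ρ : ℕ → ℝ≥0∞ → ℝ≥0∞ := fun n x => (SimpleFunc.eapprox id n x⁻¹)⁻¹
  have ρm : ∀ n, Measurable (ρ n) := fun n =>
    ((SimpleFunc.measurable _).comp measurable_inv).inv
  have ρanti : ∀ x, Antitone fun n => ρ n x := fun x i j hij =>
    ENNReal.inv_le_inv.2 (SimpleFunc.monotone_eapprox id hij x⁻¹)
  have ρlim : ∀ x, Tendsto (fun n => ρ n x) atTop (𝓝 x) := fun x => by
    have := (continuous_inv.tendsto _).comp (SimpleFunc.tendsto_eapprox (f := id) measurable_id x⁻¹)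
    rw [id, inv_inv] at this
    exact this
  have ρge : ∀ n x, x ≤ ρ n x := fun n x => (ρanti x).le_of_tendsto (ρlim x) n
  let R : ℕ → Finset ℝ≥0∞ := fun n => (SimpleFunc.eapprox (id : ℝ≥0∞ → ℝ≥0∞) n).range.image (·⁻¹)
  have hR : ∀ n x, ρ n x ∈ R n := fun n x =>
    Finset.mem_image_of_mem _ (SimpleFunc.mem_range_self _ _)
  -- a functional with a discretised interference is a finite sum over the values of the latter
  have split : ∀ (f : Fin m → ℝ≥0∞ → ℝ≥0∞ → ℝ≥0∞), (∀ j r, Measurable (f j r)) → ∀ n,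
      ∫⁻ ω, expNeg (∑' p : Fin m × ℕ,
        f p.1 (ρ n (totalPower K β X Q ω)) (receivedPower K β X Q p ω)) ∂μ =
      ∑ r ∈ R n, ∫⁻ ω, expNeg (∑' p : Fin m × ℕ, f p.1 r (receivedPower K β X Q p ω)) *
        ((ρ n) ⁻¹' {r}).indicator 1 (totalPower K β X Q ω) ∂μ := by
    intro f hf n
    rw [← lintegral_finsetSum]
    · refine lintegral_congr fun ω => ?_
      rw [Finset.sum_eq_single (ρ n (totalPower K β X Q ω))]
      · simp
      · intro r _ hr
        have : totalPower K β X Q ω ∉ ρ n ⁻¹' {r} := fun h' => hr h'.symm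
        simp [this]
      · exact fun h' => absurd (hR n _) h'
    · intro r _
      refine Measurable.mul (measurable_expNeg.comp
        (Measurable.tsum fun p => (hf p.1 r).comp (mV p))) ?_
      exact (measurable_one.indicator (ρm n (measurableSet_singleton r))).comp mI
  have eq_n : ∀ n, ∫⁻ ω, expNeg (∑' p : Fin m × ℕ,
        g p.1 (ρ n (totalPower K β X Q ω)) (receivedPower K β X Q p ω)) ∂μ =
      ∫⁻ ω, expNeg (∑' p : Fin m × ℕ, tierAverage w fun j =>
        g j (ρ n (totalPower K β X Q ω)) (receivedPower K β X Q p ω)) ∂μ := fun n => by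
    rw [split g hg n, split (fun _ r v => tierAverage w fun j => g j r v) (fun _ => mb) n]
    refine Finset.sum_congr rfl fun r _ => ?_
    exact h.lintegral_expNeg_mul_eq_of_average hK hβ hl hν hmom hw hΛ (fun j => hg j r) (mb r)
      (fun v => expNeg_tierAverage hw _)
      (measurable_one.indicator (ρm n (measurableSet_singleton r)))
  have meas : ∀ (f : Fin m → ℝ≥0∞ → ℝ≥0∞ → ℝ≥0∞), (∀ j r, Measurable (f j r)) → ∀ n p,
      Measurable fun ω => f p.1 (ρ n (totalPower K β X Q ω)) (receivedPower K β X Q p ω) := by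
    intro f hf n p
    have : (fun ω => f p.1 (ρ n (totalPower K β X Q ω)) (receivedPower K β X Q p ω)) = fun ω =>
        ∑ r ∈ R n, f p.1 r (receivedPower K β X Q p ω) *
          ((ρ n) ⁻¹' {r}).indicator 1 (totalPower K β X Q ω) := by
      ext ω
      rw [Finset.sum_eq_single (ρ n (totalPower K β X Q ω))]
      · simp
      · intro r _ hr
        have : totalPower K β X Q ω ∉ ρ n ⁻¹' {r} := fun h' => hr h'.symm
        simp [this]
      · exact fun h' => absurd (hR n _) h'
    rw [this]
    exact Finset.measurable_fun_sum _ fun r _ => ((hf p.1 r).comp (mV p)).mul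
      ((measurable_one.indicator (ρm n (measurableSet_singleton r))).comp mI)
  have lim : ∀ (f : Fin m → ℝ≥0∞ → ℝ≥0∞ → ℝ≥0∞), (∀ j r, Measurable (f j r)) →
      (∀ j v, Antitone fun r => f j r v) →
      (∀ j v (u : ℕ → ℝ≥0∞) (r : ℝ≥0∞), (∀ n, r ≤ u n) → Tendsto u atTop (𝓝 r) →
        Tendsto (fun n => f j (u n) v) atTop (𝓝 (f j r v))) →
      Tendsto (fun n => ∫⁻ ω, expNeg (∑' p : Fin m × ℕ,
        f p.1 (ρ n (totalPower K β X Q ω)) (receivedPower K β X Q p ω)) ∂μ) atTop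
        (𝓝 (∫⁻ ω, expNeg (∑' p : Fin m × ℕ,
          f p.1 (totalPower K β X Q ω) (receivedPower K β X Q p ω)) ∂μ)) := by
    intro f hf fa fc
    refine tendsto_lintegral_expNeg (fun n => Measurable.tsum fun p => meas f hf n p) fun ω =>
      ENNReal.tendsto_tsum_of_monotone (fun p i j hij => fa p.1 _ (ρanti _ hij)) fun p =>
        fc p.1 _ _ _ (fun n => ρge n _) (ρlim _)
  refine tendsto_nhds_unique (lim g hg ganti gcont) ?_
  simp_rw [eq_n]
  refine lim (fun _ r v => tierAverage w fun j => g j r v) (fun _ => mb) ?_ ?_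
  · exact fun _ v r r' hr => monotone_tierAverage w fun j => ganti j v hr
  · intro _ v u r hu hlim
    exact ((continuous_tierAverage hw).tendsto _).comp
      (tendsto_pi_nhds.2 fun j => gcont j v u r hu hlim)

end IsMultiTierNetwork
end

/-! ### The number of stations with high SINR -/

lemma ENNReal.lt_div_add_mul_tsub_iff {t W γ V I : ℝ≥0∞} (ht0 : t ≠ 0) (ht : t ≠ ∞) (hγ : γ ≠ ∞)
    (hV : V ≠ ∞) (hVI : V ≤ I) :
    t < V / (W + γ * (I - V)) ↔ t * (W + γ * I) < (1 + t * γ) * V := by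
  rw [ENNReal.lt_div_iff_mul_lt (Or.inr ht) (Or.inr ht0),
    ← ENNReal.add_lt_add_iff_right (ENNReal.mul_ne_top (ENNReal.mul_ne_top ht hγ) hV)]
  have h1 : t * (W + γ * (I - V)) + t * γ * V = t * (W + γ * I) := by
    rw [mul_assoc, ← mul_add, add_assoc, ← mul_add, tsub_add_cancel_of_le hVI]
  rw [h1, add_mul, one_mul]

section
variable {Ω : Type*} {m : ℕ} {X : Fin m → ℕ → Ω → Plane} {Q : Fin m → ℕ → Ω → ℝ × ℝ}
  {K β W γ t : ℝ}

/-- The SINR of a station exceeds `t` if and only if its received power exceeds a level which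
depends only on `t` and the total power. The junk values of the division (no noise and no
interference, infinite total power) are consistent with this. -/
lemma lt_sinr_iff (ht : 0 < t) (p : Fin m × ℕ) (ω : Ω) :
    ENNReal.ofReal t < sinr K β W γ X Q p ω ↔
      ENNReal.ofReal t * (ENNReal.ofReal W + ENNReal.ofReal γ * totalPower K β X Q ω) <
        (1 + ENNReal.ofReal t * ENNReal.ofReal γ) * receivedPower K β X Q p ω :=
  ENNReal.lt_div_add_mul_tsub_iff (by simpa using ht) ENNReal.ofReal_ne_top ENNReal.ofReal_ne_top
    ENNReal.ofReal_ne_top (ENNReal.le_tsum p)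

/-- If `n` stations have received powers `V_i` with `t (W + γ I) < (1 + t γ) V_i`, then summation
and `∑ V_i ≤ I` give `n t γ < 1 + t γ`. -/
lemma card_lt_of_forall_lt_sinr (hγ : 0 < γ) (ht : 0 < t) {ω : Ω} {A : Finset (Fin m × ℕ)}
    (hA : ∀ p ∈ A, ENNReal.ofReal t < sinr K β W γ X Q p ω) :
    (A.card : ℝ) < 1 / (γ * t) + 1 := by
  rcases A.eq_empty_or_nonempty with rfl | hne
  · simp; positivity
  set I := totalPower K β X Q ω
  set c := ENNReal.ofReal t * (ENNReal.ofReal W + ENNReal.ofReal γ * I) with hc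
  set d := 1 + ENNReal.ofReal t * ENNReal.ofReal γ with hd
  have h1 : A.card * c < d * I := by
    calc A.card * c = ∑ p ∈ A, c := by rw [Finset.sum_const, nsmul_eq_mul]
      _ < ∑ p ∈ A, d * receivedPower K β X Q p ω :=
        ENNReal.sum_lt_sum_of_nonempty hne fun p hp => (lt_sinr_iff ht p ω).1 (hA p hp)
      _ = d * ∑ p ∈ A, receivedPower K β X Q p ω := (Finset.mul_sum _ _ _).symm
      _ ≤ d * I := mul_le_mul_right (ENNReal.sum_le_tsum A) d
  have h2 : (A.card * (ENNReal.ofReal t * ENNReal.ofReal γ)) * I < d * I := by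
    refine lt_of_le_of_lt ?_ h1
    rw [mul_assoc, mul_assoc, hc]
    exact mul_le_mul_right (mul_le_mul_right le_add_self _) _
  have h3 := lt_of_mul_lt_mul_right' h2
  rw [hd, ← ENNReal.ofReal_mul ht.le, ← ENNReal.ofReal_one, ← ENNReal.ofReal_natCast,
    ← ENNReal.ofReal_mul (by positivity), ← ENNReal.ofReal_add zero_le_one (by positivity),
    ENNReal.ofReal_lt_ofReal_iff (by positivity)] at h3
  have hp : 0 < γ * t := by positivity
  rw [← sub_lt_iff_lt_add, lt_div_iff₀ hp]
  nlinarith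

lemma finite_and_ncard_le_of_lt_sinr (hγ : 0 < γ) (ht : 0 < t) (ω : Ω) :
    {p | ENNReal.ofReal t < sinr K β W γ X Q p ω}.Finite ∧
      {p | ENNReal.ofReal t < sinr K β W γ X Q p ω}.ncard ≤ ⌈1 / (γ * t)⌉₊ := by
  have key : ∀ A : Finset (Fin m × ℕ), (∀ p ∈ A, ENNReal.ofReal t < sinr K β W γ X Q p ω) →
      A.card ≤ ⌈1 / (γ * t)⌉₊ := fun A hA => by
    have h1 := card_lt_of_forall_lt_sinr hγ ht hA
    have h2 := Nat.le_ceil (1 / (γ * t))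
    have h3 : (A.card : ℝ) < ((⌈1 / (γ * t)⌉₊ + 1 : ℕ) : ℝ) := by push_cast; linarith
    exact Nat.lt_succ_iff.1 (by exact_mod_cast h3)
  have fin : {p | ENNReal.ofReal t < sinr K β W γ X Q p ω}.Finite := by
    by_contra hinf
    obtain ⟨A, hA, hcard⟩ := Set.Infinite.exists_subset_card_eq hinf (⌈1 / (γ * t)⌉₊ + 1)
    have := key A fun p hp => hA hp
    omega
  refine ⟨fin, ?_⟩
  rw [Set.ncard_eq_toFinset_card _ fin]
  exact key _ fun p hp => by simpa using hp

lemma volume_lt_unitPower_ne_top (hK : 0 < K) (hβ : 0 < β) {c : ℝ} (hc : 0 < c) :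
    volume {u | ENNReal.ofReal c < unitPower K β u} ≠ ∞ := by
  refine ((measure_mono ?_).trans_lt
    (measure_ball_lt_top (x := (0 : Plane)) (r := c⁻¹ ^ β⁻¹ / K))).ne
  intro u hu
  have h1 : c < (pathLoss K β ‖u‖)⁻¹ := (ENNReal.ofReal_lt_ofReal_iff_of_nonneg hc.le).1 hu
  have h2 : pathLoss K β ‖u‖ < c⁻¹ := (lt_inv_comm₀ hc (inv_pos.1 (hc.trans h1))).1 h1
  rw [mem_ball_zero_iff, lt_div_iff₀ hK, mul_comm,
    Real.lt_rpow_inv_iff_of_pos (by positivity) (by positivity) hβ]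
  exact h2

end

lemma lintegral_three_pow_poissonMeasure_ne_top (r : NNReal) :
    ∫⁻ n : ℕ, 3 ^ n ∂(poissonMeasure r) ≠ ∞ := by
  rw [poissonMeasure, lintegral_sum_measure]
  simp only [lintegral_smul_measure, lintegral_dirac, smul_eq_mul]
  have h : Summable fun n : ℕ => Real.exp (-r) * r ^ n / n.factorial * 3 ^ n := by
    have := (Real.summable_pow_div_factorial (r * 3)).mul_left (Real.exp (-r))
    refine this.congr fun n => ?_
    rw [mul_pow]; ring
  have h4 : ∀ n : ℕ, ENNReal.ofReal (Real.exp (-r) * r ^ n / n.factorial) * 3 ^ n =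
      ENNReal.ofReal (Real.exp (-r) * r ^ n / n.factorial * 3 ^ n) := fun n => by
    rw [ENNReal.ofReal_mul (by positivity), ENNReal.ofReal_pow (by norm_num)]
    norm_num
  simp_rw [h4]
  exact h.tsum_ofReal_ne_top

section
variable {Ω : Type*} [MeasurableSpace Ω] {μ : Measure Ω} {m : ℕ}
  {lam : Fin m → ℝ} {ν : Fin m → Measure (ℝ × ℝ)} {X : Fin m → ℕ → Ω → Plane}
  {Q : Fin m → ℕ → Ω → ℝ × ℝ} {K β W γ : ℝ}

namespace IsMultiTierNetwork

lemma measurable_sinr (h : IsMultiTierNetwork μ lam ν X Q) (p : Fin m × ℕ) :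
    Measurable (sinr K β W γ X Q p) := by
  have h1 := h.measurable_receivedPower (K := K) (β := β) p
  have h2 := h.measurable_totalPower (K := K) (β := β)
  exact h1.div (((h2.sub h1).const_mul _).const_add _)

/-- The number of stations with received power above a positive level is Poisson distributed. -/
lemma exists_map_encard_lt_receivedPower [IsProbabilityMeasure μ]
    (h : IsMultiTierNetwork μ lam ν X Q) (hK : 0 < K)
    (hβ : 0 < β) (hl : ∀ j, 0 ≤ lam j) (hν : ∀ j, ∀ᵐ q ∂(ν j), 0 < q.1 ∧ 0 < q.2)
    (hmom : ∀ j, Integrable (fun q : ℝ × ℝ => (q.2 * q.1) ^ (2 / β)) (ν j))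
    {c : ℝ} (hc : 0 < c) : ∃ r : NNReal,
    μ.map (fun ω => ({p | ENNReal.ofReal c < receivedPower K β X Q p ω}.encard : ℝ≥0∞)) =
      (poissonMeasure r).map (Nat.cast : ℕ → ℝ≥0∞) := by
  classical
  have mN : Measurable fun ω =>
      ({p | ENNReal.ofReal c < receivedPower K β X Q p ω}.encard : ℝ≥0∞) := by
    refine Measurable.of_discrete.comp (measurable_encard.comp (measurable_set_iff.2 fun p => ?_))
    exact measurable_mem.2 (measurableSet_lt measurable_const (h.measurable_receivedPower p))
  set B := {u | ENNReal.ofReal c < unitPower K β u}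
  have mB : MeasurableSet B := measurableSet_lt measurable_const (measurable_unitPower K β)
  set L := ∑ j, ENNReal.ofReal (effectiveDensity β (lam j) (ν j))
  have hκ : L * volume B ≠ ∞ := ENNReal.mul_ne_top (by simp [L])
    (volume_lt_unitPower_ne_top hK hβ hc)
  refine ⟨(L * volume B).toNNReal, ?_⟩
  have := Measure.isProbabilityMeasure_map (μ := μ) mN.aemeasurable
  have mc : Measurable (Nat.cast : ℕ → ℝ≥0∞) := Measurable.of_discrete
  have := Measure.isProbabilityMeasure_map (μ := poissonMeasure (L * volume B).toNNReal)
    mc.aemeasurable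
  refine Measure.ext_of_lintegral_expNeg fun n => ?_
  have me : Measurable fun x : ℝ≥0∞ => expNeg (n * x) :=
    measurable_expNeg.comp (measurable_id.const_mul _)
  rw [lintegral_map me mN, lintegral_map me mc, lintegral_expNeg_poissonMeasure,
    ENNReal.coe_toNNReal hκ]
  let f : ℝ≥0∞ → ℝ≥0∞ := (Set.Ioi (ENNReal.ofReal c)).indicator fun _ => n
  have mf : Measurable f := measurable_const.indicator measurableSet_Ioi
  have e1 : ∀ ω, (n : ℝ≥0∞) * {p | ENNReal.ofReal c < receivedPower K β X Q p ω}.encard =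
      ∑' p, f (receivedPower K β X Q p ω) := fun ω => by
    rw [← ENNReal.tsum_indicator_one, ← ENNReal.tsum_mul_left]
    refine tsum_congr fun p => ?_
    by_cases hp : ENNReal.ofReal c < receivedPower K β X Q p ω <;> simp [f, hp]
  simp_rw [e1]
  refine (h.lintegral_expNeg_tsum_receivedPower hK hβ hl hν hmom (g := fun _ => f)
    fun _ => mf).trans ?_
  congr 1
  have e2 : ∀ u, ∑ j, ENNReal.ofReal (effectiveDensity β (lam j) (ν j)) *
      (1 - expNeg (f (unitPower K β u))) = L * (1 - expNeg n) * B.indicator 1 u := fun u => by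
    rw [← Finset.sum_mul, mul_assoc]
    by_cases hu : u ∈ B
    · have : f (unitPower K β u) = n := Set.indicator_of_mem (s := Set.Ioi _) hu _
      simp [this, hu, L]
    · have : f (unitPower K β u) = 0 := Set.indicator_of_notMem (s := Set.Ioi _) hu _
      simp [this, hu, expNeg_zero]
  simp_rw [e2]
  rw [lintegral_const_mul _ (measurable_one.indicator mB), lintegral_indicator_one mB,
    mul_right_comm]

/-- The number of stations with SINR above `t` has an exponential moment: it is bounded for
positive `γ`, and Poisson distributed if `γ = 0`. The base `3` is what the convergence of
`∑ 2 ^ n * S_n` needs, because `∑ 2 ^ n * C(N, n) = 3 ^ N`. -/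
theorem ae_finite_and_lintegral_three_pow_ncard [IsProbabilityMeasure μ]
    (h : IsMultiTierNetwork μ lam ν X Q) (hK : 0 < K)
    (hβ : 0 < β) (hl : ∀ j, 0 ≤ lam j) (hν : ∀ j, ∀ᵐ q ∂(ν j), 0 < q.1 ∧ 0 < q.2)
    (hmom : ∀ j, Integrable (fun q : ℝ × ℝ => (q.2 * q.1) ^ (2 / β)) (ν j))
    (hγ : 0 ≤ γ) (hWγ : 0 < W ∨ 0 < γ) {t : ℝ} (ht : 0 < t) :
    (∀ᵐ ω ∂μ, {p | ENNReal.ofReal t < sinr K β W γ X Q p ω}.Finite) ∧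
      ∫⁻ ω, 3 ^ {p | ENNReal.ofReal t < sinr K β W γ X Q p ω}.ncard ∂μ ≠ ∞ := by
  rcases hγ.eq_or_lt with rfl | hγ
  · have hW : 0 < W := hWγ.resolve_right (lt_irrefl _)
    have hset : ∀ ω, {p | ENNReal.ofReal t < sinr K β W 0 X Q p ω} =
        {p | ENNReal.ofReal (t * W) < receivedPower K β X Q p ω} := fun ω => by
      ext p
      simp only [Set.mem_ofPred_eq]
      rw [lt_sinr_iff ht, ENNReal.ofReal_mul ht.le]
      simp
    simp_rw [hset]
    obtain ⟨r, hr⟩ := h.exists_map_encard_lt_receivedPower hK hβ hl hν hmom (mul_pos ht hW)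
    have mN : Measurable fun ω =>
        ({p | ENNReal.ofReal (t * W) < receivedPower K β X Q p ω}.encard : ℝ≥0∞) := by
      refine Measurable.of_discrete.comp (measurable_encard.comp (measurable_set_iff.2 fun p => ?_))
      exact measurable_mem.2 (measurableSet_lt measurable_const (h.measurable_receivedPower p))
    have mc : Measurable (Nat.cast : ℕ → ℝ≥0∞) := Measurable.of_discrete
    constructor
    · have h1 : ∀ᵐ x ∂((poissonMeasure r).map (Nat.cast : ℕ → ℝ≥0∞)), x ≠ ∞ :=
        (ae_map_iff mc.aemeasurable (measurableSet_singleton _).compl).2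
          (.of_forall fun n => by simp)
      rw [← hr] at h1
      filter_upwards [ae_of_ae_map mN.aemeasurable h1] with ω hω
      rw [← Set.encard_ne_top_iff]
      simpa using hω
    · let φ : ℝ≥0∞ → ℝ≥0∞ := fun x => 3 ^ ⌊x.toReal⌋₊
      have mφ : Measurable φ := (Measurable.of_discrete (f := fun n : ℕ => (3 : ℝ≥0∞) ^ n)).comp
        (Nat.measurable_floor.comp ENNReal.measurable_toReal)
      have e1 : ∫⁻ ω, 3 ^ {p | ENNReal.ofReal (t * W) < receivedPower K β X Q p ω}.ncard ∂μ =
          ∫⁻ x, φ x ∂(μ.map fun ω =>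
            ({p | ENNReal.ofReal (t * W) < receivedPower K β X Q p ω}.encard : ℝ≥0∞)) := by
        rw [lintegral_map mφ mN]
        refine lintegral_congr fun ω => ?_
        simp only [φ]
        congr 1
        set S := {p | ENNReal.ofReal (t * W) < receivedPower K β X Q p ω}
        rcases S.finite_or_infinite with hf | hf
        · rw [← hf.cast_ncard_eq]; simp
        · simp [hf.ncard, hf.encard_eq]
      rw [e1, hr, lintegral_map mφ mc]
      simpa [φ] using lintegral_three_pow_poissonMeasure_ne_top r
  · refine ⟨.of_forall fun ω => (finite_and_ncard_le_of_lt_sinr hγ ht ω).1, ?_⟩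
    refine ((lintegral_mono (g := fun _ => 3 ^ ⌈1 / (γ * t)⌉₊) fun ω =>
      pow_le_pow_right₀ (by norm_num) (finite_and_ncard_le_of_lt_sinr hγ ht ω).2).trans_lt ?_).ne
    simp

end IsMultiTierNetwork
end

/-! ### Elementary symmetric functions and their generating function -/

/-- The `n`-th elementary symmetric function of a family, finite or not, of extended
nonnegative numbers. -/
noncomputable def tsumEsymm {ι : Type*} (u : ι → ℝ≥0∞) (n : ℕ) : ℝ≥0∞ :=
  ∑' A : {A : Finset ι // A.card = n}, ∏ p ∈ A.1, u p

section
variable {ι : Type*}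

lemma tsumEsymm_eq_sum_powersetCard {u : ι → ℝ≥0∞} {D : Finset ι} (hu : ∀ p ∉ D, u p = 0) (n : ℕ) :
    tsumEsymm u n = ∑ A ∈ D.powersetCard n, ∏ p ∈ A, u p := by
  classical
  have h1 : tsumEsymm u n =
      ∑' A : Finset ι, {A : Finset ι | A.card = n}.indicator (fun A => ∏ p ∈ A, u p) A :=
    tsum_subtype {A : Finset ι | A.card = n} fun A => ∏ p ∈ A, u p
  rw [h1, tsum_eq_sum (s := D.powersetCard n)]
  · refine Finset.sum_congr rfl fun A hA => ?_
    exact Set.indicator_of_mem (s := {A : Finset ι | A.card = n}) (Finset.mem_powersetCard.1 hA).2 _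
  · intro A hA
    by_cases hc : A.card = n
    · have : ¬ A ⊆ D := fun h => hA (Finset.mem_powersetCard.2 ⟨h, hc⟩)
      obtain ⟨p, hp, hpD⟩ := Finset.not_subset.1 this
      rw [Set.indicator_of_mem (s := {A : Finset ι | A.card = n}) hc,
        Finset.prod_eq_zero hp (hu p hpD)]
    · exact Set.indicator_of_notMem (s := {A : Finset ι | A.card = n}) hc _

lemma tsumEsymm_indicator {S : Set ι} (hS : S.Finite) (n : ℕ) :
    tsumEsymm (S.indicator 1) n = (S.ncard.choose n : ℝ≥0∞) := by
  rw [tsumEsymm_eq_sum_powersetCard (D := hS.toFinset) (fun p hp => by simpa using hp),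
    Set.ncard_eq_toFinset_card S hS, ← Finset.card_powersetCard, Finset.cast_card]
  refine Finset.sum_congr rfl fun A hA => Finset.prod_eq_one fun p hp => ?_
  have : p ∈ S := by simpa using (Finset.mem_powersetCard.1 hA).1 hp
  simp [this]

lemma tsumEsymm_mono {u v : ι → ℝ≥0∞} (h : ∀ p, u p ≤ v p) (n : ℕ) :
    tsumEsymm u n ≤ tsumEsymm v n :=
  ENNReal.tsum_le_tsum fun _ => Finset.prod_le_prod' fun p _ => h p

/-- Every `n`-element set is the range of `n!` embeddings of `Fin n`. -/
lemma tsum_embedding_prod (u : ι → ℝ≥0∞) (n : ℕ) :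
    ∑' e : Fin n ↪ ι, ∏ i, u (e i) = n.factorial * tsumEsymm u n := by
  classical
  let f : (Fin n ↪ ι) → {A : Finset ι // A.card = n} := fun e =>
    ⟨Finset.univ.map e, by simp⟩
  rw [← (Equiv.sigmaFiberEquiv f).tsum_eq, ENNReal.tsum_sigma', tsumEsymm, ← ENNReal.tsum_mul_left]
  refine tsum_congr fun A => ?_
  have hprod : ∀ e : {e // f e = A}, ∏ i, u (e.1 i) = ∏ p ∈ A.1, u p := fun e => by
    have he : A.1 = Finset.univ.map e.1 := (congrArg Subtype.val e.2).symm
    rw [he, Finset.prod_map]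
  have eqv : {e // f e = A} ≃ (Fin n ≃ A.1) :=
    { toFun := fun e => Equiv.ofBijective
        (fun i => ⟨e.1 i, (congrArg Subtype.val e.2) ▸
          Finset.mem_map_of_mem e.1 (Finset.mem_univ i)⟩)
        ⟨fun i j hij => e.1.injective (congrArg Subtype.val hij), fun p => by
          have hp : p.1 ∈ (f e.1).1 := by rw [e.2]; exact p.2
          obtain ⟨i, _, hi⟩ := Finset.mem_map.1 hp
          exact ⟨i, Subtype.ext hi⟩⟩
      invFun := fun e => ⟨e.toEmbedding.trans (Function.Embedding.subtype _), by
        refine Subtype.ext (Finset.ext fun p => ?_)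
        simp only [f, Finset.mem_map, Finset.mem_univ, true_and]
        constructor
        · rintro ⟨i, rfl⟩; exact (e i).2
        · intro hp; exact ⟨e.symm ⟨p, hp⟩, by simp⟩⟩
      left_inv := fun e => by ext; rfl
      right_inv := fun e => by ext; rfl }
  simp only [Equiv.sigmaFiberEquiv_apply]
  simp_rw [hprod]
  rw [ENNReal.tsum_const, ENat.card_congr eqv, ENat.card_eq_coe_fintype_card,
    Fintype.card_equiv (A.1.equivFinOfCardEq A.2).symm]
  simp

/-- The generating function of the elementary symmetric functions, `∏ (1 - θ u_p)`, with the
product written as an exponential of a sum. -/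
lemma hasSum_expNeg_tsum {u G : ι → ℝ≥0∞} {D : Finset ι} (hu : ∀ p ∉ D, u p = 0)
    (hu1 : ∀ p, u p ≤ 1) {θ : ℝ} (hθ : θ ∈ Set.Icc (0 : ℝ) 1)
    (hG : ∀ p, expNeg (G p) = 1 - ENNReal.ofReal θ * u p) :
    HasSum (fun n => (-θ) ^ n * (tsumEsymm u n).toReal) (expNeg (∑' p, G p)).toReal := by
  classical
  have hG0 : ∀ p ∉ D, G p = 0 := fun p hp => strictAnti_expNeg.injective (by
    rw [hG, hu p hp, expNeg_zero]; simp)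
  have e1 : (expNeg (∑' p, G p)).toReal = ∏ p ∈ D, (1 + (-θ) * (u p).toReal) := by
    rw [tsum_eq_sum hG0, expNeg_sum, ENNReal.toReal_prod]
    refine Finset.prod_congr rfl fun p _ => ?_
    have hle : ENNReal.ofReal θ * u p ≤ 1 :=
      mul_le_one' (by simpa using hθ.2) (hu1 p)
    rw [hG, ENNReal.toReal_sub_of_le hle ENNReal.one_ne_top, ENNReal.toReal_mul,
      ENNReal.toReal_ofReal hθ.1]
    simp; ring
  have e2 : ∀ n, (-θ) ^ n * (tsumEsymm u n).toReal =
      ∑ A ∈ D.powersetCard n, ∏ p ∈ A, (-θ) * (u p).toReal := fun n => by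
    rw [tsumEsymm_eq_sum_powersetCard hu, ENNReal.toReal_sum, Finset.mul_sum]
    · refine Finset.sum_congr rfl fun A hA => ?_
      rw [Finset.prod_mul_distrib, Finset.prod_const, (Finset.mem_powersetCard.1 hA).2,
        ENNReal.toReal_prod]
    · exact fun A _ => ENNReal.prod_ne_top fun p _ => ((hu1 p).trans_lt ENNReal.one_lt_top).ne
  simp_rw [e2]
  rw [e1, Finset.prod_one_add, Finset.sum_powerset]
  refine hasSum_sum_of_ne_finset_zero fun n hn => ?_
  rw [Finset.powersetCard_eq_empty.2 (by simpa using hn), Finset.sum_empty]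

end

/-- The coefficients of a power series that vanishes on one side of `0` are zero. -/
lemma eq_zero_of_forall_hasSum_neg_pow {a : ℕ → ℝ} (ha : Summable fun n => |a n|)
    (h : ∀ θ ∈ Set.Ioo (0 : ℝ) 1, HasSum (fun n => (-θ) ^ n * a n) 0) (n : ℕ) : a n = 0 := by
  induction n using Nat.strong_induction_on with
  | _ n ih =>
    have ha' : Summable fun k => |a (k + n)| := (summable_nat_add_iff n).2 ha
    have hc : ContinuousOn (fun θ : ℝ => ∑' k, (-θ) ^ k * a (k + n)) (Set.Icc 0 1) := by
      refine continuousOn_tsum (fun k => by fun_prop) ha' fun k θ hθ => ?_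
      rw [norm_mul, norm_pow, norm_neg, Real.norm_of_nonneg hθ.1, Real.norm_eq_abs]
      exact mul_le_of_le_one_left (abs_nonneg _) (pow_le_one₀ hθ.1 hθ.2)
    have h0 : ∀ θ ∈ Set.Ioo (0 : ℝ) 1, ∑' k, (-θ) ^ k * a (k + n) = 0 := fun θ hθ => by
      have h1 := (hasSum_nat_add_iff' n).2 (h θ hθ)
      rw [Finset.sum_eq_zero fun k hk => by rw [ih k (Finset.mem_range.1 hk), mul_zero],
        sub_zero] at h1
      have h2 := h1.mul_left (((-θ) ^ n)⁻¹)
      have hne : (-θ) ^ n ≠ 0 := pow_ne_zero _ (neg_ne_zero.2 hθ.1.ne')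
      rw [mul_zero] at h2
      refine HasSum.tsum_eq ?_
      convert! h2 using 1
      ext k
      rw [pow_add]
      field_simp
    -- after division by `(-θ) ^ n`, let `θ` tend to `0`
    have t1 : Tendsto (fun θ : ℝ => ∑' k, (-θ) ^ k * a (k + n)) (𝓝[>] 0)
        (𝓝 (∑' k, (-(0 : ℝ)) ^ k * a (k + n))) :=
      (hc 0 (by simp)).mono_left (by
        rw [← nhdsWithin_Ioc_eq_nhdsGT (zero_lt_one' ℝ)]
        exact nhdsWithin_mono _ Set.Ioc_subset_Icc_self)
    have t2 : Tendsto (fun θ : ℝ => ∑' k, (-θ) ^ k * a (k + n)) (𝓝[>] 0) (𝓝 0) := by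
      refine tendsto_const_nhds.congr' ?_
      filter_upwards [Ioo_mem_nhdsGT (zero_lt_one' ℝ)] with θ hθ
      exact (h0 θ hθ).symm
    have := tendsto_nhds_unique t1 t2
    rw [tsum_eq_single 0 (fun k hk => by simp [hk])] at this
    simpa using this

/-! ### Inclusion-exclusion -/

lemma hasSum_alternating_choose_mul_choose (N k : ℕ) :
    HasSum (fun d : ℕ => (-1 : ℝ) ^ d * ((k + d).choose k : ℝ) * (N.choose (k + d) : ℝ))
      (if N = k then 1 else 0) := by
  have hsupp : ∀ d ∉ Finset.range (N - k + 1),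
      (-1 : ℝ) ^ d * ((k + d).choose k : ℝ) * (N.choose (k + d) : ℝ) = 0 := fun d hd => by
    have : N < k + d := by have := Finset.mem_range.not.1 hd; omega
    rw [Nat.choose_eq_zero_of_lt this]; simp
  suffices hs : ∑ d ∈ Finset.range (N - k + 1),
      (-1 : ℝ) ^ d * ((k + d).choose k : ℝ) * (N.choose (k + d) : ℝ) = if N = k then 1 else 0 by
    rw [← hs]; exact hasSum_sum_of_ne_finset_zero hsupp
  rcases lt_or_ge N k with hlt | hle
  · rw [if_neg hlt.ne, Finset.sum_eq_zero]
    intro d _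
    rw [Nat.choose_eq_zero_of_lt (by omega : N < k + d)]; simp
  · have h1 : ∀ d ∈ Finset.range (N - k + 1),
        (-1 : ℝ) ^ d * ((k + d).choose k : ℝ) * (N.choose (k + d) : ℝ) =
          (N.choose k : ℝ) * ((((-1) ^ d * (N - k).choose d : ℤ)) : ℝ) := by
      intro d _
      have := Nat.choose_mul (n := N) (k := k + d) (s := k) (by omega)
      rw [Nat.add_sub_cancel_left] at this
      have h' : (N.choose (k + d) : ℝ) * ((k + d).choose k : ℝ) =
          N.choose k * (N - k).choose d := by exact_mod_cast this
      push_cast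
      linear_combination (-1 : ℝ) ^ d * h'
    rw [Finset.sum_congr rfl h1, ← Finset.mul_sum, ← Int.cast_sum, Int.alternating_sum_range_choose]
    by_cases hNk : N = k
    · subst hNk; simp
    · rw [if_neg hNk, if_neg (by omega)]; simp

lemma hasSum_alternating_choose_pred_mul_choose (N k : ℕ) :
    HasSum (fun d : ℕ => (-1 : ℝ) ^ d * ((k + d).choose k : ℝ) * (N.choose (k + 1 + d) : ℝ))
      (if k + 1 ≤ N then 1 else 0) := by
  induction N with
  | zero =>
    convert! hasSum_zero using 1
    ext d
    rw [Nat.choose_eq_zero_of_lt (by omega : 0 < k + 1 + d)]; simp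
  | succ N ih =>
    convert! (hasSum_alternating_choose_mul_choose N k).add ih using 1
    · ext d
      rw [add_right_comm k 1 d, Nat.choose_succ_succ' N (k + d)]
      push_cast; ring
    · split_ifs <;> first | omega | norm_num

section
variable {Ω ι : Type*} [MeasurableSpace Ω] {μ : Measure Ω}

/-- Termwise integration of an absolutely convergent series of real multiples. -/
lemma MeasureTheory.hasSum_mul_toReal_lintegral {κ : Type*} [Countable κ] {e : κ → Ω → ℝ≥0∞}
    {c : κ → ℝ} {F : Ω → ℝ}
    (he : ∀ n, Measurable (e n)) (hfin : ∀ n, ∫⁻ ω, e n ω ∂μ ≠ ∞)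
    (hsum : ∑' n, ENNReal.ofReal |c n| * ∫⁻ ω, e n ω ∂μ ≠ ∞)
    (hF : ∀ᵐ ω ∂μ, HasSum (fun n => c n * (e n ω).toReal) (F ω)) :
    HasSum (fun n => c n * (∫⁻ ω, e n ω ∂μ).toReal) (∫ ω, F ω ∂μ) := by
  have hint : ∀ n, ∫ ω, (e n ω).toReal ∂μ = (∫⁻ ω, e n ω ∂μ).toReal := fun n =>
    integral_toReal (he n).aemeasurable (ae_lt_top (he n) (hfin n))
  have h1 := hasSum_integral_of_summable_integral_norm (μ := μ)
    (F := fun n ω => c n * (e n ω).toReal)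
    (fun n => (integrable_toReal_of_lintegral_ne_top (he n).aemeasurable (hfin n)).const_mul (c n))
    (by
      refine (ENNReal.summable_toReal hsum).congr fun n => ?_
      simp_rw [norm_mul, Real.norm_eq_abs, abs_of_nonneg ENNReal.toReal_nonneg, integral_const_mul,
        hint, ENNReal.toReal_mul, ENNReal.toReal_ofReal (abs_nonneg _)])
  simp_rw [integral_const_mul, hint] at h1
  convert! h1 using 1
  refine integral_congr_ae ?_
  filter_upwards [hF] with ω hω
  exact hω.tsum_eq.symm

lemma measurable_tsumEsymm [Countable ι] {u : ι → Ω → ℝ≥0∞} (hu : ∀ p, Measurable (u p)) (n : ℕ) :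
    Measurable fun ω => tsumEsymm (fun p => u p ω) n :=
  Measurable.tsum fun _ => Finset.measurable_fun_prod _ fun p _ => hu p

lemma tsum_two_pow_mul_lintegral_tsumEsymm_ne_top [Countable ι] {u : ι → Ω → ℝ≥0∞} {S : Ω → Set ι}
    (hu : ∀ p, Measurable (u p)) (huS : ∀ p ω, u p ω ≤ (S ω).indicator 1 p)
    (hS : ∀ᵐ ω ∂μ, (S ω).Finite) (hS3 : ∫⁻ ω, 3 ^ (S ω).ncard ∂μ ≠ ∞) :
    ∑' n, 2 ^ n * ∫⁻ ω, tsumEsymm (fun p => u p ω) n ∂μ ≠ ∞ := by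
  have hm := fun n => measurable_tsumEsymm hu n
  simp_rw [← lintegral_const_mul _ (hm _)]
  rw [← lintegral_tsum fun n => ((hm n).const_mul _).aemeasurable]
  refine ((lintegral_mono_ae ?_).trans_lt hS3.lt_top).ne
  filter_upwards [hS] with ω hω
  calc ∑' n, 2 ^ n * tsumEsymm (fun p => u p ω) n
      ≤ ∑' n, (2 : ℝ≥0∞) ^ n * ((S ω).ncard.choose n : ℝ≥0∞) := by
        refine ENNReal.tsum_le_tsum fun n => mul_le_mul_right ?_ _
        rw [← tsumEsymm_indicator hω]
        exact tsumEsymm_mono (fun p => huS p ω) n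
    _ = ∑ n ∈ Finset.range ((S ω).ncard + 1), (2 : ℝ≥0∞) ^ n * ((S ω).ncard.choose n : ℝ≥0∞) := by
        refine tsum_eq_sum fun n hn => ?_
        rw [Nat.choose_eq_zero_of_lt (by simpa using hn)]; simp
    _ = 3 ^ (S ω).ncard := by
        rw [← (by norm_num : (2 : ℝ≥0∞) + 1 = 3), add_pow]; simp

lemma lintegral_tsumEsymm_ne_top [Countable ι] {u : ι → Ω → ℝ≥0∞} {S : Ω → Set ι}
    (hu : ∀ p, Measurable (u p)) (huS : ∀ p ω, u p ω ≤ (S ω).indicator 1 p)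
    (hS : ∀ᵐ ω ∂μ, (S ω).Finite) (hS3 : ∫⁻ ω, 3 ^ (S ω).ncard ∂μ ≠ ∞) (n : ℕ) :
    ∫⁻ ω, tsumEsymm (fun p => u p ω) n ∂μ ≠ ∞ := by
  have h := ENNReal.ne_top_of_tsum_ne_top
    (tsum_two_pow_mul_lintegral_tsumEsymm_ne_top hu huS hS hS3) n
  intro h'
  rw [h', ENNReal.mul_top (by simp)] at h
  exact h rfl

lemma hasSum_mul_toReal_lintegral_tsumEsymm [Countable ι] {u : ι → Ω → ℝ≥0∞} {S : Ω → Set ι}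
    (hu : ∀ p, Measurable (u p)) (huS : ∀ p ω, u p ω ≤ (S ω).indicator 1 p)
    (hS : ∀ᵐ ω ∂μ, (S ω).Finite) (hS3 : ∫⁻ ω, 3 ^ (S ω).ncard ∂μ ≠ ∞) {k : ℕ} {c : ℕ → ℝ}
    (hc : ∀ d, |c d| ≤ 2 ^ (k + d)) {F : Ω → ℝ}
    (hF : ∀ᵐ ω ∂μ, HasSum (fun d => c d * (tsumEsymm (fun p => u p ω) (k + d)).toReal) (F ω)) :
    HasSum (fun d => c d * (∫⁻ ω, tsumEsymm (fun p => u p ω) (k + d) ∂μ).toReal)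
      (∫ ω, F ω ∂μ) := by
  refine hasSum_mul_toReal_lintegral (fun d => measurable_tsumEsymm hu (k + d))
    (fun d => lintegral_tsumEsymm_ne_top hu huS hS hS3 (k + d)) ?_ hF
  refine (lt_of_le_of_lt ?_
    (tsum_two_pow_mul_lintegral_tsumEsymm_ne_top hu huS hS hS3).lt_top).ne
  refine (ENNReal.tsum_le_tsum fun d => mul_le_mul_left ?_ _).trans
    (ENNReal.tsum_comp_le_tsum_of_injective (add_right_injective k)
      fun n => 2 ^ n * ∫⁻ ω, tsumEsymm (fun p => u p ω) n ∂μ)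
  calc ENNReal.ofReal |c d| ≤ ENNReal.ofReal (2 ^ (k + d)) := ENNReal.ofReal_le_ofReal (hc d)
    _ = 2 ^ (k + d) := by rw [ENNReal.ofReal_pow (by norm_num)]; norm_num

/-- The inclusion-exclusion identities hold pointwise for the binomial coefficients `C(N, n)` of
the coverage number `N`, and may be integrated since `3 ^ N` is integrable. -/
theorem hasSum_symmetricSum [Countable ι] {Z : ι → Ω → ℝ≥0∞} {T : ι → ℝ}
    (hZ : ∀ p, Measurable (Z p))
    (hS : ∀ᵐ ω ∂μ, {p | ENNReal.ofReal (T p) < Z p ω}.Finite)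
    (hS3 : ∫⁻ ω, 3 ^ {p | ENNReal.ofReal (T p) < Z p ω}.ncard ∂μ ≠ ∞) {k : ℕ} (hk : 1 ≤ k) :
    HasSum (fun d : ℕ => (-1 : ℝ) ^ d * ((k + d - 1).choose (k - 1) : ℝ) *
        (symmetricSum μ Z T (k + d)).toReal) (μ.real {ω | (k : ℕ∞) ≤ coverageNumber Z T ω}) ∧
      HasSum (fun d : ℕ => (-1 : ℝ) ^ d * ((k + d).choose k : ℝ) *
        (symmetricSum μ Z T (k + d)).toReal) (μ.real {ω | coverageNumber Z T ω = (k : ℕ∞)}) := by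
  obtain ⟨k, rfl⟩ : ∃ j, k = j + 1 := ⟨k - 1, by omega⟩
  set S : Ω → Set ι := fun ω => {p | ENNReal.ofReal (T p) < Z p ω}
  let u : ι → Ω → ℝ≥0∞ := fun p => {ω | ENNReal.ofReal (T p) < Z p ω}.indicator 1
  have mS : ∀ p, MeasurableSet {ω | ENNReal.ofReal (T p) < Z p ω} := fun p =>
    measurableSet_lt measurable_const (hZ p)
  have hu : ∀ p, Measurable (u p) := fun p => measurable_one.indicator (mS p)
  have huS : ∀ ω, (fun p => u p ω) = (S ω).indicator 1 := fun ω => by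
    ext p
    by_cases hp : ENNReal.ofReal (T p) < Z p ω <;> simp [u, S, hp]
  have hle : ∀ p ω, u p ω ≤ (S ω).indicator 1 p := fun p ω => (congrFun (huS ω) p).le
  have hsym : ∀ n, symmetricSum μ Z T n = ∫⁻ ω, tsumEsymm (fun p => u p ω) n ∂μ := fun _ => rfl
  have mN : Measurable (coverageNumber Z T) :=
    measurable_encard.comp (measurable_set_iff.2 fun p => measurable_mem.2 (mS p))
  have hN : ∀ ω, (S ω).Finite → coverageNumber Z T ω = ((S ω).ncard : ℕ∞) := fun ω hω =>
    hω.cast_ncard_eq.symm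
  have hchoose : ∀ ω, (S ω).Finite → ∀ n,
      tsumEsymm (fun p => u p ω) n = ((S ω).ncard.choose n : ℝ≥0∞) := fun ω hω n => by
    rw [huS, tsumEsymm_indicator hω]
  have bound : ∀ d a b : ℕ, a ≤ k + 1 + d →
      |(-1 : ℝ) ^ d * (a.choose b : ℝ)| ≤ 2 ^ (k + 1 + d) := by
    intro d a b ha
    rw [abs_mul, abs_pow, abs_neg, abs_one, one_pow, one_mul, Nat.abs_cast]
    have h1 : ((a.choose b : ℕ) : ℝ) ≤ ((2 ^ a : ℕ) : ℝ) := by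
      exact_mod_cast Nat.choose_le_two_pow a b
    push_cast at h1
    exact h1.trans (pow_le_pow_right₀ one_le_two ha)
  simp_rw [hsym]
  constructor
  · rw [← integral_indicator_one (s := {ω | ((k + 1 : ℕ) : ℕ∞) ≤ coverageNumber Z T ω})
      (mN (MeasurableSet.of_discrete (s := Set.Ici ((k + 1 : ℕ) : ℕ∞))))]
    refine hasSum_mul_toReal_lintegral_tsumEsymm hu hle hS hS3
      (fun d => bound d _ _ (by omega)) ?_
    filter_upwards [hS] with ω hω
    simp_rw [hchoose ω hω, ENNReal.toReal_natCast]
    convert! hasSum_alternating_choose_pred_mul_choose (S ω).ncard k using 1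
    · ext d
      rw [add_right_comm, Nat.add_sub_cancel, Nat.add_sub_cancel]
    · simp only [Set.indicator_apply, Set.mem_ofPred_eq, hN ω hω, Nat.cast_le, Pi.one_apply]
  · rw [← integral_indicator_one (s := {ω | coverageNumber Z T ω = ((k + 1 : ℕ) : ℕ∞)})
      (mN (measurableSet_singleton ((k + 1 : ℕ) : ℕ∞)))]
    refine hasSum_mul_toReal_lintegral_tsumEsymm hu hle hS hS3
      (fun d => bound d _ _ (by omega)) ?_
    filter_upwards [hS] with ω hω
    simp_rw [hchoose ω hω, ENNReal.toReal_natCast]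
    convert! hasSum_alternating_choose_mul_choose (S ω).ncard (k + 1) using 1
    simp only [Set.indicator_apply, Set.mem_ofPred_eq, hN ω hω, Nat.cast_inj, Pi.one_apply]
end

/-! ### Symmetric sums in terms of factorial moment measures -/

lemma effectiveDensity_pos {β lam : ℝ} {ν : Measure (ℝ × ℝ)} [IsProbabilityMeasure ν]
    (hl : 0 < lam) (hν : ∀ᵐ q ∂ν, 0 < q.1 ∧ 0 < q.2)
    (hmom : Integrable (fun q : ℝ × ℝ => (q.2 * q.1) ^ (2 / β)) ν) :
    0 < effectiveDensity β lam ν := by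
  have hpos : ∀ᵐ q ∂ν, 0 < (q.2 * q.1) ^ (2 / β) := by
    filter_upwards [hν] with q hq
    exact Real.rpow_pos_of_pos (mul_pos hq.2 hq.1) _
  have hnn : 0 ≤ᵐ[ν] fun q : ℝ × ℝ => (q.2 * q.1) ^ (2 / β) := by
    filter_upwards [hpos] with q hq using hq.le
  refine mul_pos hl ((integral_nonneg_of_ae hnn).lt_of_ne' fun h0 => ?_)
  obtain ⟨q, h1, h2⟩ := (hpos.and ((integral_eq_zero_iff_of_nonneg_ae hnn hmom).1 h0)).exists
  exact h1.ne' h2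

section
variable {Ω : Type*} [MeasurableSpace Ω] {μ : Measure Ω} [IsProbabilityMeasure μ] {m : ℕ}
  {lam τ : Fin m → ℝ} {ν : Fin m → Measure (ℝ × ℝ)} {X : Fin m → ℕ → Ω → Plane}
  {Q : Fin m → ℕ → Ω → ℝ × ℝ} {K β W γ : ℝ} {w : Fin m → ℝ≥0∞} {Λ : ℝ≥0∞}

namespace IsMultiTierNetwork

/-- The averaging over the tier labels for the functional that charges `a` for each station with
SINR above the threshold of its tier. -/
lemma lintegral_expNeg_tsum_sinr_eq (h : IsMultiTierNetwork μ lam ν X Q) (hK : 0 < K)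
    (hβ : 0 < β) (hl : ∀ j, 0 ≤ lam j) (hν : ∀ j, ∀ᵐ q ∂(ν j), 0 < q.1 ∧ 0 < q.2)
    (hmom : ∀ j, Integrable (fun q : ℝ × ℝ => (q.2 * q.1) ^ (2 / β)) (ν j))
    (hw : ∑ j, w j = 1)
    (hΛ : ∀ j, ENNReal.ofReal (effectiveDensity β (lam j) (ν j)) = Λ * w j)
    (hτ : ∀ j, 0 < τ j) (a : ℝ≥0∞) :
    ∫⁻ ω, expNeg (∑' p : Fin m × ℕ,
        if ENNReal.ofReal (τ p.1) < sinr K β W γ X Q p ω then a else 0) ∂μ =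
      ∫⁻ ω, expNeg (∑' p : Fin m × ℕ, tierAverage w fun j =>
        if ENNReal.ofReal (τ j) < sinr K β W γ X Q p ω then a else 0) ∂μ := by
  classical
  simp_rw [lt_sinr_iff (hτ _)]
  have mono : ∀ (j : Fin m) {r r' : ℝ≥0∞}, r ≤ r' →
      ENNReal.ofReal (τ j) * (ENNReal.ofReal W + ENNReal.ofReal γ * r) ≤
        ENNReal.ofReal (τ j) * (ENNReal.ofReal W + ENNReal.ofReal γ * r') := fun j r r' hr => by
    gcongr
  refine h.lintegral_expNeg_tsum_eq_tierAverage hK hβ hl hν hmom hw hΛ (g := fun j r v =>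
    if ENNReal.ofReal (τ j) * (ENNReal.ofReal W + ENNReal.ofReal γ * r) <
      (1 + ENNReal.ofReal (τ j) * ENNReal.ofReal γ) * v then a else 0) ?_ ?_ ?_
  · intro j r
    exact Measurable.ite (measurableSet_lt measurable_const (measurable_id.const_mul _))
      measurable_const measurable_const
  · intro j v r r' hr
    beta_reduce
    split_ifs with h1 h2
    · exact le_rfl
    · exact absurd ((mono j hr).trans_lt h1) h2
    · exact bot_le
    · exact le_rfl
  · intro j v u r hu hlim
    split_ifs with h1
    · have ht : Tendsto (fun n => ENNReal.ofReal (τ j) *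
          (ENNReal.ofReal W + ENNReal.ofReal γ * u n)) atTop
          (𝓝 (ENNReal.ofReal (τ j) * (ENNReal.ofReal W + ENNReal.ofReal γ * r))) :=
        ENNReal.Tendsto.const_mul (tendsto_const_nhds.add
          (ENNReal.Tendsto.const_mul hlim (Or.inr ENNReal.ofReal_ne_top)))
          (Or.inr ENNReal.ofReal_ne_top)
      refine tendsto_const_nhds.congr' ?_
      filter_upwards [ht.eventually_lt_const h1] with n hn
      rw [if_pos hn]
    · refine tendsto_const_nhds.congr fun n => ?_
      rw [if_neg fun hn => h1 ((mono j (hu n)).trans_lt hn)]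

/-- The symmetric sums do not change when the indicator that a station covers is replaced by its
average over a random tier with law `w`: the generating functions in `θ = 1 - exp (-a)` agree. -/
theorem lintegral_tsumEsymm_eq (h : IsMultiTierNetwork μ lam ν X Q) (hK : 0 < K)
    (hβ : 0 < β) (hl : ∀ j, 0 ≤ lam j) (hν : ∀ j, ∀ᵐ q ∂(ν j), 0 < q.1 ∧ 0 < q.2)
    (hmom : ∀ j, Integrable (fun q : ℝ × ℝ => (q.2 * q.1) ^ (2 / β)) (ν j))
    (hw : ∑ j, w j = 1)
    (hΛ : ∀ j, ENNReal.ofReal (effectiveDensity β (lam j) (ν j)) = Λ * w j)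
    (hγ : 0 ≤ γ) (hWγ : 0 < W ∨ 0 < γ) (hτ : ∀ j, 0 < τ j) {t : ℝ} (ht : 0 < t)
    (htτ : ∀ j, t ≤ τ j) (n : ℕ) :
    ∫⁻ ω, tsumEsymm (fun p : Fin m × ℕ =>
        if ENNReal.ofReal (τ p.1) < sinr K β W γ X Q p ω then 1 else 0) n ∂μ =
      ∫⁻ ω, tsumEsymm (fun p : Fin m × ℕ => ∑ j, w j *
        if ENNReal.ofReal (τ j) < sinr K β W γ X Q p ω then 1 else 0) n ∂μ := by
  classical
  obtain ⟨hS, hS3⟩ :=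
    h.ae_finite_and_lintegral_three_pow_ncard hK hβ hl hν hmom hγ hWγ ht
  set Z := sinr K β W γ X Q
  have mZ : ∀ p, Measurable (Z p) := fun p => h.measurable_sinr p
  have mite : ∀ (b : ℝ≥0∞) (s : ℝ) (p : Fin m × ℕ), Measurable fun ω =>
      if ENNReal.ofReal s < Z p ω then b else 0 := fun b s p =>
    Measurable.ite (measurableSet_lt measurable_const (mZ p)) measurable_const measurable_const
  set S : Ω → Set (Fin m × ℕ) := fun ω => {p | ENNReal.ofReal t < Z p ω}
  have hnot : ∀ {ω p}, p ∉ S ω → ∀ j, ¬ ENNReal.ofReal (τ j) < Z p ω := fun hp j hj =>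
    hp ((ENNReal.ofReal_le_ofReal (htτ j)).trans_lt hj)
  let u₁ : Fin m × ℕ → Ω → ℝ≥0∞ := fun p ω => if ENNReal.ofReal (τ p.1) < Z p ω then 1 else 0
  let u₂ : Fin m × ℕ → Ω → ℝ≥0∞ := fun p ω =>
    ∑ j, w j * if ENNReal.ofReal (τ j) < Z p ω then 1 else 0
  have mu₁ : ∀ p, Measurable (u₁ p) := fun p => mite _ _ p
  have mu₂ : ∀ p, Measurable (u₂ p) := fun p =>
    Finset.measurable_fun_sum _ fun j _ => (mite _ _ p).const_mul _
  have u₁le : ∀ p ω, u₁ p ω ≤ 1 := fun p ω => by simp only [u₁]; split_ifs <;> simp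
  have u₂le : ∀ p ω, u₂ p ω ≤ 1 := fun p ω => by
    rw [← hw]
    refine Finset.sum_le_sum fun j _ => mul_le_of_le_one_right' ?_
    split_ifs <;> simp
  have u₁S : ∀ p ω, p ∉ S ω → u₁ p ω = 0 := fun p ω hp => if_neg (hnot hp _)
  have u₂S : ∀ p ω, p ∉ S ω → u₂ p ω = 0 := fun p ω hp =>
    Finset.sum_eq_zero fun j _ => by rw [if_neg (hnot hp _), mul_zero]
  have ind : ∀ {v : Fin m × ℕ → Ω → ℝ≥0∞}, (∀ p ω, v p ω ≤ 1) → (∀ p ω, p ∉ S ω → v p ω = 0) →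
      ∀ p ω, v p ω ≤ (S ω).indicator 1 p := fun h1 h2 p ω => by
    by_cases hp : p ∈ S ω
    · simpa [hp] using h1 p ω
    · simp [h2 p ω hp]
  -- the generating function of the symmetric sums, for either of the two families
  have gen : ∀ {v G : Fin m × ℕ → Ω → ℝ≥0∞}, (∀ p, Measurable (v p)) → (∀ p ω, v p ω ≤ 1) →
      (∀ p ω, p ∉ S ω → v p ω = 0) → (∀ p, Measurable (G p)) → ∀ {θ : ℝ}, θ ∈ Set.Icc (0 : ℝ) 1 →
      (∀ p ω, expNeg (G p ω) = 1 - ENNReal.ofReal θ * v p ω) →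
      HasSum (fun n => (-θ) ^ n * (∫⁻ ω, tsumEsymm (fun p => v p ω) n ∂μ).toReal)
        (∫⁻ ω, expNeg (∑' p, G p ω) ∂μ).toReal := by
    intro v G mv v1 vS mG θ hθ hG
    have mE : Measurable fun ω => expNeg (∑' p, G p ω) :=
      measurable_expNeg.comp (Measurable.tsum mG)
    rw [← integral_toReal mE.aemeasurable
      (.of_forall fun ω => (expNeg_ne_top _).lt_top)]
    have := hasSum_mul_toReal_lintegral_tsumEsymm (k := 0) (c := fun n => (-θ) ^ n) mv (ind v1 vS)
      hS hS3 (F := fun ω => (expNeg (∑' p, G p ω)).toReal) (fun n => by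
        rw [abs_pow, abs_neg, abs_of_nonneg hθ.1]
        exact pow_le_pow_left₀ hθ.1 (hθ.2.trans one_le_two) _ |>.trans (by simp)) (by
        filter_upwards [hS] with ω hω
        simp only [zero_add]
        exact hasSum_expNeg_tsum (D := hω.toFinset)
          (fun p hp => vS p ω fun h' => hp (hω.mem_toFinset.2 h'))
          (fun p => v1 p ω) hθ fun p => hG p ω)
    simpa only [zero_add] using this
  have hfin₁ := fun n => lintegral_tsumEsymm_ne_top mu₁ (ind u₁le u₁S) hS hS3 n
  have hfin₂ := fun n => lintegral_tsumEsymm_ne_top mu₂ (ind u₂le u₂S) hS hS3 n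
  have summ : ∀ {v : Fin m × ℕ → Ω → ℝ≥0∞}, (∀ p, Measurable (v p)) → (∀ p ω, v p ω ≤ 1) →
      (∀ p ω, p ∉ S ω → v p ω = 0) →
      Summable fun n => (∫⁻ ω, tsumEsymm (fun p => v p ω) n ∂μ).toReal := fun mv v1 vS =>
    ENNReal.summable_toReal (((ENNReal.tsum_le_tsum fun n => le_mul_of_one_le_left'
      (one_le_pow₀ one_le_two)).trans_lt
      (tsum_two_pow_mul_lintegral_tsumEsymm_ne_top mv (ind v1 vS) hS hS3).lt_top).ne)
  have key := eq_zero_of_forall_hasSum_neg_pow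
    (a := fun n => (∫⁻ ω, tsumEsymm (fun p => u₁ p ω) n ∂μ).toReal -
      (∫⁻ ω, tsumEsymm (fun p => u₂ p ω) n ∂μ).toReal)
    ((summ mu₁ u₁le u₁S).sub (summ mu₂ u₂le u₂S)).abs (fun θ hθ => by
      have hθ' : θ ∈ Set.Icc (0 : ℝ) 1 := Set.Ioo_subset_Icc_self hθ
      have hθ1 : ENNReal.ofReal θ ≤ 1 := by simpa using hθ'.2
      set a := negLog (1 - ENNReal.ofReal θ)
      have ha : expNeg a = 1 - ENNReal.ofReal θ := expNeg_negLog tsub_le_self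
      have hite : ∀ (s : ℝ) p ω, expNeg (if ENNReal.ofReal s < Z p ω then a else 0) =
          1 - ENNReal.ofReal θ * (if ENNReal.ofReal s < Z p ω then 1 else 0) := fun s p ω => by
        split_ifs
        · rw [ha, mul_one]
        · rw [expNeg_zero, mul_zero, tsub_zero]
      have g₁ := gen mu₁ u₁le u₁S (G := fun p ω =>
        if ENNReal.ofReal (τ p.1) < Z p ω then a else 0) (fun p => mite _ _ p) hθ'
        fun p ω => hite _ p ω
      have g₂ := gen mu₂ u₂le u₂S (G := fun p ω => tierAverage w fun j =>
        if ENNReal.ofReal (τ j) < Z p ω then a else 0) (fun p =>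
          (continuous_tierAverage hw).measurable.comp (measurable_pi_lambda _ fun j => mite _ _ p))
        hθ' fun p ω => by
          have hne : ENNReal.ofReal θ * u₂ p ω ≠ ∞ :=
            ENNReal.mul_ne_top ENNReal.ofReal_ne_top ((u₂le p ω).trans_lt ENNReal.one_lt_top).ne
          refine ENNReal.eq_sub_of_add_eq hne ?_
          rw [expNeg_tierAverage hw, Finset.mul_sum, ← Finset.sum_add_distrib]
          refine Eq.trans ?_ hw
          refine Finset.sum_congr rfl fun j _ => ?_
          rw [hite, mul_left_comm, ← mul_add, tsub_add_cancel_of_le, mul_one]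
          split_ifs <;> simp [hθ'.2]
      rw [h.lintegral_expNeg_tsum_sinr_eq hK hβ hl hν hmom hw hΛ hτ a] at g₁
      have := g₁.sub g₂
      rw [sub_self] at this
      simpa only [mul_sub] using this) n
  exact (ENNReal.toReal_eq_toReal_iff' (hfin₁ n) (hfin₂ n)).1 (sub_eq_zero.1 key)

end IsMultiTierNetwork
end

/-- Expanding the product of the tier averages over an ordered `n`-tuple of stations gives the
factorial moment measures at all choices of thresholds. -/
lemma sum_factorialMoment_mul_prod {Ω ι : Type*} [MeasurableSpace Ω] {μ : Measure Ω} [Countable ι]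
    {Z : ι → Ω → ℝ≥0∞} (hZ : ∀ p, Measurable (Z p)) {m : ℕ} (τ : Fin m → ℝ) (w : Fin m → ℝ≥0∞)
    (n : ℕ) :
    ∑ i : Fin n → Fin m, factorialMoment μ Z (fun j => τ (i j)) * ∏ j, w (i j) =
      n.factorial * ∫⁻ ω, tsumEsymm (fun p => ∑ j, w j *
        if ENNReal.ofReal (τ j) < Z p ω then 1 else 0) n ∂μ := by
  have : Countable (Fin n ↪ ι) := DFunLike.coe_injective.countable
  have mS : ∀ (s : ℝ) p, MeasurableSet {ω | ENNReal.ofReal s < Z p ω} := fun s p =>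
    measurableSet_lt measurable_const (hZ p)
  have mite : ∀ (s : ℝ) p, Measurable fun ω =>
      if ENNReal.ofReal s < Z p ω then (1 : ℝ≥0∞) else 0 := fun s p =>
    Measurable.ite (mS s p) measurable_const measurable_const
  have mF : ∀ i : Fin n → Fin m, Measurable fun ω => ∑' e : Fin n ↪ ι, ∏ j : Fin n,
      {ω' | ENNReal.ofReal (τ (i j)) < Z (e j) ω'}.indicator (1 : Ω → ℝ≥0∞) ω := fun i =>
    Measurable.tsum fun e => Finset.measurable_fun_prod _ fun j _ =>
      measurable_one.indicator (mS _ _)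
  rw [← lintegral_const_mul _ (measurable_tsumEsymm (fun p =>
    Finset.measurable_fun_sum _ fun j _ => (mite _ p).const_mul _) n)]
  simp_rw [factorialMoment, ← lintegral_mul_const _ (mF _)]
  rw [← lintegral_finsetSum _ fun i _ => (mF i).mul_const _]
  refine lintegral_congr fun ω => ?_
  rw [← tsum_embedding_prod]
  simp_rw [← ENNReal.tsum_mul_right]
  rw [← Summable.tsum_finsetSum fun _ _ => ENNReal.summable]
  refine tsum_congr fun e => ?_
  rw [Finset.prod_univ_sum, Fintype.piFinset_univ]
  refine Finset.sum_congr rfl fun i _ => ?_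
  rw [← Finset.prod_mul_distrib]
  refine Finset.prod_congr rfl fun j _ => ?_
  rw [mul_comm, Set.indicator_apply]
  rfl


theorem mainTheorem8 {Ω : Type*} [MeasurableSpace Ω] (μ : Measure Ω) [IsProbabilityMeasure μ]
    {m : ℕ} (hm : 1 ≤ m)
    (K β W γ : ℝ) (hK : 0 < K) (hβ : 2 < β) (hW : 0 ≤ W) (hγ : γ ∈ Set.Icc (0 : ℝ) 1)
    (hWγ : 0 < W ∨ 0 < γ)
    (lam τ : Fin m → ℝ) (hlam : ∀ j, 0 < lam j) (hτ : ∀ j, 0 < τ j)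
    (ν : Fin m → Measure (ℝ × ℝ)) (hν : ∀ j, ∀ᵐ q ∂(ν j), 0 < q.1 ∧ 0 < q.2)
    (hmom : ∀ j, Integrable (fun q : ℝ × ℝ => (q.2 * q.1) ^ (2 / β)) (ν j))
    (X : Fin m → ℕ → Ω → Plane) (Q : Fin m → ℕ → Ω → ℝ × ℝ)
    (hnet : IsMultiTierNetwork μ lam ν X Q)
    (lamStar : Fin m → ℝ) (hlamStar : ∀ j, lamStar j = effectiveDensity β (lam j) (ν j))
    (Z : Fin m × ℕ → Ω → ℝ≥0∞) (hZ : Z = sinr K β W γ X Q)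
    (T : Fin m × ℕ → ℝ) (hT : ∀ p, T p = τ p.1) :
    -- the symmetric sums in terms of the factorial moment measures of the SINR process
    (∀ n : ℕ, symmetricSum μ Z T n ≠ ∞ ∧
      symmetricSum μ Z T n =
        (n.factorial : ℝ≥0∞)⁻¹ * ∑ i : Fin n → Fin m,
          factorialMoment μ Z (fun j => τ (i j)) *
            ∏ j : Fin n, ENNReal.ofReal (lamStar (i j) / ∑ l, lamStar l)) ∧
    -- the coverage probabilities through the inclusion-exclusion identities
    (∀ k : ℕ, 1 ≤ k →
      HasSum (fun d : ℕ => (-1 : ℝ) ^ d * ((k + d - 1).choose (k - 1) : ℝ) *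
        (symmetricSum μ Z T (k + d)).toReal) (μ.real {ω | (k : ℕ∞) ≤ coverageNumber Z T ω}) ∧
      HasSum (fun d : ℕ => (-1 : ℝ) ^ d * ((k + d).choose k : ℝ) *
        (symmetricSum μ Z T (k + d)).toReal) (μ.real {ω | coverageNumber Z T ω = (k : ℕ∞)})) ∧
    -- for `γ > 0` only finitely many terms are nonzero
    (0 < γ → ∀ tmin : ℝ, 0 < tmin → (∀ j, tmin ≤ τ j) →
      (∀ n : ℕ, 1 / (γ * tmin) + 1 ≤ (n : ℝ) → symmetricSum μ Z T n = 0) ∧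
      ∀ k : ℕ, 1 ≤ k →
        μ.real {ω | (k : ℕ∞) ≤ coverageNumber Z T ω} =
          ∑ n ∈ Finset.Icc k ⌈1 / (γ * tmin)⌉₊,
            (-1 : ℝ) ^ (n - k) * ((n - 1).choose (k - 1) : ℝ) * (symmetricSum μ Z T n).toReal ∧
        μ.real {ω | coverageNumber Z T ω = (k : ℕ∞)} =
          ∑ n ∈ Finset.Icc k ⌈1 / (γ * tmin)⌉₊,
            (-1 : ℝ) ^ (n - k) * (n.choose k : ℝ) * (symmetricSum μ Z T n).toReal) := by
  classical
  have hβ0 : 0 < β := by linarith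
  have hl : ∀ j, 0 ≤ lam j := fun j => (hlam j).le
  have : Nonempty (Fin m) := ⟨⟨0, hm⟩⟩
  obtain ⟨j₀, hj₀⟩ := Finite.exists_min τ
  -- the tier probabilities
  have hpos : ∀ j, 0 < lamStar j := fun j => by
    have := (hnet.tier j).isProbabilityMeasure
    rw [hlamStar]
    exact effectiveDensity_pos (hlam j) (hν j) (hmom j)
  have hL : 0 < ∑ l, lamStar l := Finset.sum_pos (fun j _ => hpos j) Finset.univ_nonempty
  set w : Fin m → ℝ≥0∞ := fun j => ENNReal.ofReal (lamStar j / ∑ l, lamStar l) with hwdef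
  have hw : ∑ j, w j = 1 := by
    rw [← ENNReal.ofReal_sum_of_nonneg fun j _ => (div_pos (hpos j) hL).le, ← Finset.sum_div,
      div_self hL.ne', ENNReal.ofReal_one]
  have hΛ : ∀ j, ENNReal.ofReal (effectiveDensity β (lam j) (ν j)) =
      ENNReal.ofReal (∑ l, lamStar l) * w j := fun j => by
    rw [← hlamStar, hwdef, ← ENNReal.ofReal_mul hL.le, mul_div_cancel₀ _ hL.ne']
  have mZ : ∀ p, Measurable (Z p) := fun p => hZ ▸ hnet.measurable_sinr p
  -- the covering stations are among those with an SINR value above the least threshold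
  obtain ⟨hS, hS3⟩ := hnet.ae_finite_and_lintegral_three_pow_ncard hK hβ0 hl hν hmom hγ.1 hWγ
    (hτ j₀)
  rw [← hZ] at hS hS3
  have hsub : ∀ ω, {p | ENNReal.ofReal (T p) < Z p ω} ⊆ {p | ENNReal.ofReal (τ j₀) < Z p ω} :=
    fun ω p hp => (ENNReal.ofReal_le_ofReal ((hj₀ p.1).trans (hT p).ge)).trans_lt hp
  have hD : ∀ᵐ ω ∂μ, {p | ENNReal.ofReal (T p) < Z p ω}.Finite := by
    filter_upwards [hS] with ω hω using hω.subset (hsub ω)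
  have hD3 : ∫⁻ ω, 3 ^ {p | ENNReal.ofReal (T p) < Z p ω}.ncard ∂μ ≠ ∞ := by
    refine ((lintegral_mono_ae ?_).trans_lt hS3.lt_top).ne
    filter_upwards [hS] with ω hω
    exact pow_le_pow_right₀ (by norm_num) (Set.ncard_le_ncard (hsub ω) hω)
  have hsym : ∀ n, symmetricSum μ Z T n = ∫⁻ ω, tsumEsymm (fun p : Fin m × ℕ =>
      if ENNReal.ofReal (τ p.1) < sinr K β W γ X Q p ω then 1 else 0) n ∂μ := fun n => by
    subst hZ
    simp only [symmetricSum, tsumEsymm, hT, Set.indicator_apply]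
    rfl
  have hincl := fun (k : ℕ) (hk : 1 ≤ k) => hasSum_symmetricSum mZ hD hD3 hk
  refine ⟨fun n => ⟨?_, ?_⟩, hincl, fun hγ0 tmin htmin hmin => ?_⟩
  · refine lintegral_tsumEsymm_ne_top
      (u := fun p => {ω' | ENNReal.ofReal (T p) < Z p ω'}.indicator 1)
      (fun p => measurable_one.indicator (measurableSet_lt measurable_const (mZ p)))
      (fun p ω => ?_) hD hD3 n
    simp [Set.indicator_apply]
  · rw [sum_factorialMoment_mul_prod mZ τ w n, hsym,
      hnet.lintegral_tsumEsymm_eq hK hβ0 hl hν hmom hw hΛ hγ.1 hWγ hτ (hτ j₀) hj₀ n, ← mul_assoc,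
      ENNReal.inv_mul_cancel (by exact_mod_cast n.factorial_ne_zero) (ENNReal.natCast_ne_top _),
      one_mul, hZ]
  · have hzero : ∀ n : ℕ, 1 / (γ * tmin) + 1 ≤ (n : ℝ) → symmetricSum μ Z T n = 0 := by
      intro n hn
      rw [hsym]
      refine (lintegral_congr fun ω => ?_).trans lintegral_zero
      refine ENNReal.tsum_eq_zero.2 fun A => ?_
      by_contra hne
      have hall : ∀ p ∈ A.1, ENNReal.ofReal tmin < sinr K β W γ X Q p ω := fun p hp => by
        have := Finset.prod_ne_zero_iff.1 hne p hp
        exact (ENNReal.ofReal_le_ofReal (hmin p.1)).trans_lt (by simpa using this)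
      have := card_lt_of_forall_lt_sinr hγ0 htmin hall
      rw [A.2] at this
      linarith
    refine ⟨hzero, fun k hk => ?_⟩
    set M := ⌈1 / (γ * tmin)⌉₊
    have truncate : ∀ {c : ℕ → ℕ → ℝ} {x : ℝ},
        HasSum (fun d => (-1 : ℝ) ^ d * c (k + d) k * (symmetricSum μ Z T (k + d)).toReal) x →
        x = ∑ n ∈ Finset.Icc k M, (-1 : ℝ) ^ (n - k) * c n k * (symmetricSum μ Z T n).toReal := by
      intro c x hx
      refine hx.unique ?_
      rw [← Finset.Ico_add_one_right_eq_Icc, Finset.sum_Ico_eq_sum_range]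
      simp_rw [Nat.add_sub_cancel_left]
      refine hasSum_sum_of_ne_finset_zero fun d hd => ?_
      have hle : M + 1 ≤ k + d := by have := Finset.mem_range.not.1 hd; omega
      have h1 : ((M + 1 : ℕ) : ℝ) ≤ ((k + d : ℕ) : ℝ) := by exact_mod_cast hle
      have h2 := Nat.le_ceil (1 / (γ * tmin))
      rw [hzero (k + d) (by push_cast at h1 ⊢; linarith)]
      simp
    exact ⟨truncate (c := fun n k => ((n - 1).choose (k - 1) : ℝ)) (hincl k hk).1,
      truncate (c := fun n k => (n.choose k : ℝ)) (hincl k hk).2⟩
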